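/- Let $m\in\mathbb N$, let $\Omega\subseteq\mathbb R^m$ be open and let $\sigma\ge 1$. Multi-indices are $\alpha\in\mathbb Z_+^m$, with $|\alpha|=\alpha_1+\dots+\alpha_m$ and $\alpha!=\alpha_1!\cdots\alpha_m!$. **The algebra.** Let $\mathcal E_m^\sigma(\Omega)$ be the algebra of nets $(f_\varepsilon)_{\varepsilon\in]0,1]}$ of functions in $C^\infty(\Omega;\mathbb C)$ such that for every compact $K\subset\Omega$ and every $\alpha$ there are $k>0$, $c>0$, $\varepsilon_0\in]0,1]$ with $$\sup_{x\in K}|\partial^\alpha f_\varepsilon(x)|\le c\exp\bigl(k\varepsilon^{-\frac1{2\sigma-1}}\bigr)\quad\text{for all }\varepsilon\le\varepsilon_0 .$$ Let $\mathcal N^\sigma(\Omega)$ be its ideal of nets such that for every compact $K\subset\Omega$, every $\alpha$ and every $k>0$ there are $c>0$, $\varepsilon_0\in]0,1]$ with $$\sup_{x\in K}|\partial^\alpha f_\varepsilon(x)|\le c\exp\bigl(-k\varepsilon^{-\frac1{2\sigma-1}}\bigr)\quad\text{for all }\varepsilon\le\varepsilon_0 .$$ The algebra of generalized Gevrey ultradistributions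 of order $\sigma$ is $\mathcal G^\sigma(\Omega)=\mathcal E_m^\sigma(\Omega)/\mathcal N^\sigma(\Omega)$. **Test functions.** Let $D^\sigma(\Omega)$ be the set of $\varphi\in C^\infty(\Omega;\mathbb C)$ with compact support in $\Omega$ such that for every compact $K\subset\Omega$ there is $c>0$ with $\sup_K|\partial^\alpha\varphi|\le c^{|\alpha|+1}(\alpha!)^\sigma$ for all $\alpha$. Such a $\varphi$ is regarded as an element of $\mathcal G^\sigma(\Omega)$ through the constant net. **The wave front.** Write $\mathcal F(u)(\xi)=\int e^{-ix\cdot\xi}u(x)\,dx$. For $h\in\mathcal G^\sigma(\Omega)$ with compact support, $\Sigma_g^\sigma(h)\subseteq\mathbb R^m\setminus\{0\}$ is the complement in $\mathbb R^m\setminus\{0\}$ of the set of $\xi_0$ that have an open conic neighbourhood $\Gamma$ such that, for some representative $(h_\varepsilon)_\varepsilon$ of $h$ whose members are all supported in one compact subset of $\Omega$, there are $k_1,k_2,c>0$ and $\varepsilon_0\in]0,1]$ with $$|\mathcal F(h_\varepsilon)(\xi)|\le c\exp\bigl(k_1\varepsilon^{-\frac1{2\sigma-1}}-k_2|\xi|^{\frac1\sigma}\bigr)\quad\text{for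 all }\xi\in\Gamma,\ \varepsilon\le\varepsilon_0 .$$ For $f\in\mathcal G^\sigma(\Omega)$ and $x_0\in\Omega$ let $\Sigma_{g,x_0}^\sigma(f)\subseteq\mathbb R^m\setminus\{0\}$ be the intersection of the sets $\Sigma_g^\sigma(\varphi f)$ over all $\varphi\in D^\sigma(\Omega)$ that are equal to $1$ on a neighbourhood of $x_0$ (it is $\mathbb R^m\setminus\{0\}$ if there is no such $\varphi$), and let $$WF_g^\sigma(f)=\{(x,\xi)\in\Omega\times(\mathbb R^m\setminus\{0\}) : \xi\in\Sigma_{g,x}^\sigma(f)\}.$$ For $f,g\in\mathcal G^\sigma(\Omega)$ put $$WF_g^\sigma(f)+WF_g^\sigma(g)=\{(x,\xi+\eta) : (x,\xi)\in WF_g^\sigma(f),\ (x,\eta)\in WF_g^\sigma(g)\}.$$ **Theorem.** Let $f,g\in\mathcal G^\sigma(\Omega)$ be such that $(x,0)\notin WF_g^\sigma(f)+WF_g^\sigma(g)$ for every $x\in\Omega$. Then $$WF_g^\sigma(fg)\subseteq\bigl(WF_g^\sigma(f)+WF_g^\sigma(g)\bigr)\cup WF_g^\sigma(f)\cup WF_g^\sigma(g).$$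 -/

import Mathlib

open Set Filter Topology MeasureTheory
open scoped ContDiff

noncomputable section

namespace GevreyUltra

/-- The Euclidean space `ℝᵐ`. -/
abbrev Eu (m : ℕ) : Type := EuclideanSpace ℝ (Fin m)

/-! ### Partial derivatives -/

/-- The partial derivative `∂_i f`. -/
def pderiv {m : ℕ} (i : Fin m) (f : Eu m → ℂ) : Eu m → ℂ :=
  fun x => fderiv ℝ f x (EuclideanSpace.single i 1)

/-- The iterated partial derivative `∂_{i₁} ∂_{i₂} ⋯ ∂_{iₙ} f` for the list `[i₁, …, iₙ]`. -/
def listDeriv {m : ℕ} (L : List (Fin m)) (f : Eu m → ℂ) : Eu m → ℂ :=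
  L.foldr pderiv f

/-- The list in which the index `i` occurs `α i` times, in increasing order. -/
def multiList {m : ℕ} (α : Fin m → ℕ) : List (Fin m) :=
  (List.finRange m).flatMap fun i => List.replicate (α i) i

/-- The derivative `∂^α f = ∂₁^{α₁} ⋯ ∂ₘ^{αₘ} f` for a multi-index `α`. -/
def multiDeriv {m : ℕ} (α : Fin m → ℕ) (f : Eu m → ℂ) : Eu m → ℂ :=
  listDeriv (multiList α) f

/-- The length `|α| = α₁ + ⋯ + αₘ`. -/
def multiLength {m : ℕ} (α : Fin m → ℕ) : ℕ := ∑ i, α i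

/-- The factorial `α! = α₁! ⋯ αₘ!`. -/
def multiFactorial {m : ℕ} (α : Fin m → ℕ) : ℕ := ∏ i, (α i).factorial

/-! ### Moderate and null nets

A net in `C^∞(Ω)^{]0,1]}` is represented by functions on all of `ℝᵐ` that are smooth on `Ω`.
Values outside `Ω` are irrelevant: two nets that agree on `Ω` differ by a null net, so the quotient
algebra below is the one formed from functions on `Ω` only. -/

/-- Families `(f_ε)` of functions `ℝᵐ → ℂ`, indexed by `ε ∈ ]0,1]`. -/
abbrev Net (m : ℕ) : Type := Ioc (0 : ℝ) 1 → Eu m → ℂ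

/-- The quantity `ε ^ (-1 / (2σ - 1))`. -/
def scale (σ : ℝ) (ε : Ioc (0 : ℝ) 1) : ℝ := (ε : ℝ) ^ (-(1 / (2 * σ - 1)))

/-- Moderate growth of a net of functions, on every compact subset of `Ω`. -/
def ModerateBound {m : ℕ} (σ : ℝ) (Ω : TopologicalSpace.Opens (Eu m)) (u : Net m) : Prop :=
  ∀ K : Set (Eu m), IsCompact K → K ⊆ Ω → ∃ k > (0 : ℝ), ∃ c > (0 : ℝ), ∃ ε₀ : Ioc (0 : ℝ) 1,
    ∀ ε ≤ ε₀, ∀ x ∈ K, ‖u ε x‖ ≤ c * Real.exp (k * scale σ ε)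

/-- Null growth of a net of functions, on every compact subset of `Ω`. -/
def NullBound {m : ℕ} (σ : ℝ) (Ω : TopologicalSpace.Opens (Eu m)) (u : Net m) : Prop :=
  ∀ K : Set (Eu m), IsCompact K → K ⊆ Ω → ∀ k > (0 : ℝ), ∃ c > (0 : ℝ), ∃ ε₀ : Ioc (0 : ℝ) 1,
    ∀ ε ≤ ε₀, ∀ x ∈ K, ‖u ε x‖ ≤ c * Real.exp (-(k * scale σ ε))

/-- Every member of the net is `C^∞` on `Ω`. -/
def SmoothNet {m : ℕ} (Ω : TopologicalSpace.Opens (Eu m)) (u : Net m) : Prop :=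
  ∀ ε, ContDiffOn ℝ ∞ (u ε) Ω

/-- Membership in `E_m^σ(Ω)`. -/
def IsModerate {m : ℕ} (σ : ℝ) (Ω : TopologicalSpace.Opens (Eu m)) (u : Net m) : Prop :=
  SmoothNet Ω u ∧ ∀ α : Fin m → ℕ, ModerateBound σ Ω fun ε => multiDeriv α (u ε)

/-- Membership in `N^σ(Ω)`. -/
def IsNull {m : ℕ} (σ : ℝ) (Ω : TopologicalSpace.Opens (Eu m)) (u : Net m) : Prop :=
  SmoothNet Ω u ∧ ∀ α : Fin m → ℕ, NullBound σ Ω fun ε => multiDeriv α (u ε)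

/-! ### Helper facts: the moderate nets form an algebra and the null nets an ideal -/

section helpers

variable {m : ℕ} {σ : ℝ} {Ω : TopologicalSpace.Opens (Eu m)}

theorem listDeriv_append (L L' : List (Fin m)) (f : Eu m → ℂ) :
    listDeriv (L ++ L') f = listDeriv L (listDeriv L' f) := by
  simp [listDeriv, List.foldr_append]

theorem pderiv_congr {f g : Eu m → ℂ} (h : EqOn f g Ω) (i : Fin m) :
    EqOn (pderiv i f) (pderiv i g) Ω := by
  intro x hx
  have : f =ᶠ[𝓝 x] g := by
    filter_upwards [Ω.isOpen.mem_nhds hx] with y hy using h hy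
  simp [pderiv, this.fderiv_eq]

theorem listDeriv_congr {f g : Eu m → ℂ} (h : EqOn f g Ω) (L : List (Fin m)) :
    EqOn (listDeriv L f) (listDeriv L g) Ω := by
  induction L with
  | nil => exact h
  | cons i L ih => exact pderiv_congr ih i

theorem pderiv_smooth {f : Eu m → ℂ} (h : ContDiffOn ℝ ∞ f Ω) (i : Fin m) :
    ContDiffOn ℝ ∞ (pderiv i f) Ω := by
  have := h.fderiv_of_isOpen Ω.isOpen (m := ∞) (by simp)
  exact this.clm_apply contDiffOn_const

theorem listDeriv_smooth {f : Eu m → ℂ} (h : ContDiffOn ℝ ∞ f Ω) (L : List (Fin m)) :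
    ContDiffOn ℝ ∞ (listDeriv L f) Ω := by
  induction L with
  | nil => exact h
  | cons i L ih => exact pderiv_smooth ih i

theorem smooth_differentiableAt {f : Eu m → ℂ} (h : ContDiffOn ℝ ∞ f Ω) {x : Eu m} (hx : x ∈ Ω) :
    DifferentiableAt ℝ f x :=
  (h.contDiffAt (Ω.isOpen.mem_nhds hx)).differentiableAt (by simp)

theorem pderiv_comm {f : Eu m → ℂ} (h : ContDiffOn ℝ ∞ f Ω) (i j : Fin m) :
    EqOn (pderiv i (pderiv j f)) (pderiv j (pderiv i f)) Ω := by
  intro x hx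
  have hc : ContDiffAt ℝ ∞ f x := h.contDiffAt (Ω.isOpen.mem_nhds hx)
  have hs : IsSymmSndFDerivAt ℝ f x :=
    hc.isSymmSndFDerivAt (by
      rw [minSmoothness_of_isRCLikeNormedField]
      exact WithTop.coe_le_coe.2 le_top)
  have hd : DifferentiableAt ℝ (fderiv ℝ f) x :=
    ((hc.fderiv_right (m := ∞) (by simp)).differentiableAt (by simp))
  have key : ∀ a b : Eu m, fderiv ℝ (fun y => fderiv ℝ f y a) x b = fderiv ℝ (fderiv ℝ f) x b a := by
    intro a b
    rw [fderiv_clm_apply hd (differentiableAt_const a)]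
    simp
  show fderiv ℝ (fun y => fderiv ℝ f y _) x _ = fderiv ℝ (fun y => fderiv ℝ f y _) x _
  rw [key, key]
  exact hs _ _

theorem listDeriv_perm {f : Eu m → ℂ} (h : ContDiffOn ℝ ∞ f Ω) {L L' : List (Fin m)}
    (hL : L.Perm L') : EqOn (listDeriv L f) (listDeriv L' f) Ω := by
  induction hL with
  | nil => exact fun _ _ => rfl
  | cons i _ ih => exact pderiv_congr ih i
  | swap i j L => exact pderiv_comm (listDeriv_smooth h L) j i
  | trans _ _ ih₁ ih₂ => exact ih₁.trans ih₂

theorem multiList_count (α : Fin m → ℕ) (i : Fin m) : (multiList α).count i = α i := by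
  rw [multiList, List.count_flatMap]
  have : (List.count i ∘ fun j => List.replicate (α j) j) = fun j => if j = i then α j else 0 := by
    funext j
    simp [List.count_replicate]
  rw [this, ← List.ofFn_eq_map, List.sum_ofFn]
  simp

theorem perm_multiList (L : List (Fin m)) : L.Perm (multiList fun i => L.count i) := by
  rw [List.perm_iff_count]
  intro i
  rw [multiList_count]

theorem ModerateBound.congr {u v : Net m} (h : ModerateBound σ Ω u) (huv : ∀ ε, EqOn (u ε) (v ε) Ω) :
    ModerateBound σ Ω v := by
  intro K hK hKΩ
  obtain ⟨k, hk, c, hc, ε₀, H⟩ := h K hK hKΩ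
  exact ⟨k, hk, c, hc, ε₀, fun ε hε x hx => by rw [← huv ε (hKΩ hx)]; exact H ε hε x hx⟩

theorem NullBound.congr {u v : Net m} (h : NullBound σ Ω u) (huv : ∀ ε, EqOn (u ε) (v ε) Ω) :
    NullBound σ Ω v := by
  intro K hK hKΩ k hk
  obtain ⟨c, hc, ε₀, H⟩ := h K hK hKΩ k hk
  exact ⟨c, hc, ε₀, fun ε hε x hx => by rw [← huv ε (hKΩ hx)]; exact H ε hε x hx⟩

theorem scale_nonneg (σ : ℝ) (ε : Ioc (0 : ℝ) 1) : 0 ≤ scale σ ε :=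
  Real.rpow_nonneg ε.2.1.le _

theorem ModerateBound.add {u v : Net m} (hu : ModerateBound σ Ω u) (hv : ModerateBound σ Ω v) :
    ModerateBound σ Ω (u + v) := by
  intro K hK hKΩ
  obtain ⟨k, hk, c, hc, ε₀, H⟩ := hu K hK hKΩ
  obtain ⟨k', hk', c', hc', ε₀', H'⟩ := hv K hK hKΩ
  refine ⟨k + k', by positivity, c + c', by positivity, min ε₀ ε₀', fun ε hε x hx => ?_⟩
  have h1 := H ε (hε.trans (min_le_left _ _)) x hx
  have h2 := H' ε (hε.trans (min_le_right _ _)) x hx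
  have hs := scale_nonneg σ ε
  have e1 : Real.exp (k * scale σ ε) ≤ Real.exp ((k + k') * scale σ ε) :=
    Real.exp_le_exp.2 (by nlinarith)
  have e2 : Real.exp (k' * scale σ ε) ≤ Real.exp ((k + k') * scale σ ε) :=
    Real.exp_le_exp.2 (by nlinarith)
  calc ‖(u + v) ε x‖ ≤ ‖u ε x‖ + ‖v ε x‖ := norm_add_le _ _
    _ ≤ c * Real.exp (k * scale σ ε) + c' * Real.exp (k' * scale σ ε) := add_le_add h1 h2
    _ ≤ c * Real.exp ((k + k') * scale σ ε) + c' * Real.exp ((k + k') * scale σ ε) := by gcongr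
    _ = _ := by ring

theorem ModerateBound.mul {u v : Net m} (hu : ModerateBound σ Ω u) (hv : ModerateBound σ Ω v) :
    ModerateBound σ Ω (u * v) := by
  intro K hK hKΩ
  obtain ⟨k, hk, c, hc, ε₀, H⟩ := hu K hK hKΩ
  obtain ⟨k', hk', c', hc', ε₀', H'⟩ := hv K hK hKΩ
  refine ⟨k + k', by positivity, c * c', by positivity, min ε₀ ε₀', fun ε hε x hx => ?_⟩
  have h1 := H ε (hε.trans (min_le_left _ _)) x hx
  have h2 := H' ε (hε.trans (min_le_right _ _)) x hx
  calc ‖(u * v) ε x‖ = ‖u ε x‖ * ‖v ε x‖ := norm_mul _ _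
    _ ≤ (c * Real.exp (k * scale σ ε)) * (c' * Real.exp (k' * scale σ ε)) := by gcongr
    _ = _ := by rw [add_mul, Real.exp_add]; ring

theorem NullBound.add {u v : Net m} (hu : NullBound σ Ω u) (hv : NullBound σ Ω v) :
    NullBound σ Ω (u + v) := by
  intro K hK hKΩ k hk
  obtain ⟨c, hc, ε₀, H⟩ := hu K hK hKΩ k hk
  obtain ⟨c', hc', ε₀', H'⟩ := hv K hK hKΩ k hk
  refine ⟨c + c', by positivity, min ε₀ ε₀', fun ε hε x hx => ?_⟩
  have h1 := H ε (hε.trans (min_le_left _ _)) x hx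
  have h2 := H' ε (hε.trans (min_le_right _ _)) x hx
  calc ‖(u + v) ε x‖ ≤ ‖u ε x‖ + ‖v ε x‖ := norm_add_le _ _
    _ ≤ _ := by rw [add_mul]; exact add_le_add h1 h2

theorem ModerateBound.mul_null {u v : Net m} (hu : ModerateBound σ Ω u) (hv : NullBound σ Ω v) :
    NullBound σ Ω (u * v) := by
  intro K hK hKΩ k hk
  obtain ⟨k₁, hk₁, c, hc, ε₀, H⟩ := hu K hK hKΩ
  obtain ⟨c', hc', ε₀', H'⟩ := hv K hK hKΩ (k + k₁) (by positivity)
  refine ⟨c * c', by positivity, min ε₀ ε₀', fun ε hε x hx => ?_⟩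
  have h1 := H ε (hε.trans (min_le_left _ _)) x hx
  have h2 := H' ε (hε.trans (min_le_right _ _)) x hx
  calc ‖(u * v) ε x‖ = ‖u ε x‖ * ‖v ε x‖ := norm_mul _ _
    _ ≤ (c * Real.exp (k₁ * scale σ ε)) * (c' * Real.exp (-((k + k₁) * scale σ ε))) := by gcongr
    _ = (c * c') * (Real.exp (k₁ * scale σ ε) * Real.exp (-((k + k₁) * scale σ ε))) := by ring
    _ = _ := by rw [← Real.exp_add]; ring_nf

theorem listDeriv_add {f g : Eu m → ℂ} (hf : ContDiffOn ℝ ∞ f Ω) (hg : ContDiffOn ℝ ∞ g Ω)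
    (L : List (Fin m)) : EqOn (listDeriv L (f + g)) (listDeriv L f + listDeriv L g) Ω := by
  induction L with
  | nil => exact fun _ _ => rfl
  | cons i L ih =>
    intro x hx
    have h1 := pderiv_congr ih i hx
    simp only [listDeriv, List.foldr_cons] at h1 ⊢
    rw [h1]
    have d1 := smooth_differentiableAt (listDeriv_smooth hf L) hx
    have d2 := smooth_differentiableAt (listDeriv_smooth hg L) hx
    simp only [listDeriv] at d1 d2
    simp only [pderiv, Pi.add_apply]
    rw [fderiv_add d1 d2]
    rfl

theorem pderiv_mul {f g : Eu m → ℂ} (hf : ContDiffOn ℝ ∞ f Ω) (hg : ContDiffOn ℝ ∞ g Ω)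
    (i : Fin m) : EqOn (pderiv i (f * g)) (pderiv i f * g + f * pderiv i g) Ω := by
  intro x hx
  simp only [pderiv, Pi.add_apply, Pi.mul_apply]
  rw [fderiv_mul (smooth_differentiableAt hf hx) (smooth_differentiableAt hg hx)]
  simp
  ring

theorem IsModerate.list {u : Net m} (h : IsModerate σ Ω u) (L : List (Fin m)) :
    ModerateBound σ Ω fun ε => listDeriv L (u ε) :=
  (h.2 _).congr fun ε => (listDeriv_perm (h.1 ε) (perm_multiList L)).symm

theorem IsNull.list {u : Net m} (h : IsNull σ Ω u) (L : List (Fin m)) :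
    NullBound σ Ω fun ε => listDeriv L (u ε) :=
  (h.2 _).congr fun ε => (listDeriv_perm (h.1 ε) (perm_multiList L)).symm

theorem IsModerate.pderiv {u : Net m} (h : IsModerate σ Ω u) (i : Fin m) :
    IsModerate σ Ω fun ε => pderiv i (u ε) :=
  ⟨fun ε => pderiv_smooth (h.1 ε) i, fun α => by
    have := h.list (multiList α ++ [i])
    simp only [listDeriv_append] at this
    exact this⟩

theorem IsNull.pderiv {u : Net m} (h : IsNull σ Ω u) (i : Fin m) :
    IsNull σ Ω fun ε => pderiv i (u ε) :=
  ⟨fun ε => pderiv_smooth (h.1 ε) i, fun α => by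
    have := h.list (multiList α ++ [i])
    simp only [listDeriv_append] at this
    exact this⟩

theorem listDeriv_snoc_mul {f g : Eu m → ℂ} (hf : ContDiffOn ℝ ∞ f Ω) (hg : ContDiffOn ℝ ∞ g Ω)
    (L : List (Fin m)) (i : Fin m) :
    EqOn (listDeriv (L ++ [i]) (f * g))
      (listDeriv L (pderiv i f * g) + listDeriv L (f * pderiv i g)) Ω := by
  rw [listDeriv_append]
  exact (listDeriv_congr (pderiv_mul hf hg i) L).trans
    (listDeriv_add ((pderiv_smooth hf i).mul hg) (hf.mul (pderiv_smooth hg i)) L)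

theorem mul_list_moderate (L : List (Fin m)) : ∀ {u v : Net m}, IsModerate σ Ω u →
    IsModerate σ Ω v → ModerateBound σ Ω fun ε => listDeriv L (u ε * v ε) := by
  induction L using List.reverseRecOn with
  | nil => exact fun hu hv => (hu.list []).mul (hv.list [])
  | append_singleton L i ih =>
    intro u v hu hv
    exact ((ih (hu.pderiv i) hv).add (ih hu (hv.pderiv i))).congr
      fun ε => (listDeriv_snoc_mul (hu.1 ε) (hv.1 ε) L i).symm

theorem mul_list_null (L : List (Fin m)) : ∀ {u v : Net m}, IsModerate σ Ω u →
    IsNull σ Ω v → NullBound σ Ω fun ε => listDeriv L (u ε * v ε) := by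
  induction L using List.reverseRecOn with
  | nil => exact fun hu hv => (hu.list []).mul_null (hv.list [])
  | append_singleton L i ih =>
    intro u v hu hv
    exact ((ih (hu.pderiv i) hv).add (ih hu (hv.pderiv i))).congr
      fun ε => (listDeriv_snoc_mul (hu.1 ε) (hv.1 ε) L i).symm

theorem IsModerate.mul {u v : Net m} (hu : IsModerate σ Ω u) (hv : IsModerate σ Ω v) :
    IsModerate σ Ω (u * v) :=
  ⟨fun ε => (hu.1 ε).mul (hv.1 ε), fun α => mul_list_moderate (multiList α) hu hv⟩

theorem IsModerate.add {u v : Net m} (hu : IsModerate σ Ω u) (hv : IsModerate σ Ω v) :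
    IsModerate σ Ω (u + v) :=
  ⟨fun ε => (hu.1 ε).add (hv.1 ε), fun α => ((hu.2 α).add (hv.2 α)).congr
    fun ε => (listDeriv_add (hu.1 ε) (hv.1 ε) (multiList α)).symm⟩

theorem IsModerate.mul_null {u v : Net m} (hu : IsModerate σ Ω u) (hv : IsNull σ Ω v) :
    IsNull σ Ω (u * v) :=
  ⟨fun ε => (hu.1 ε).mul (hv.1 ε), fun α => mul_list_null (multiList α) hu hv⟩

theorem IsNull.add {u v : Net m} (hu : IsNull σ Ω u) (hv : IsNull σ Ω v) :
    IsNull σ Ω (u + v) :=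
  ⟨fun ε => (hu.1 ε).add (hv.1 ε), fun α => ((hu.2 α).add (hv.2 α)).congr
    fun ε => (listDeriv_add (hu.1 ε) (hv.1 ε) (multiList α)).symm⟩

/-- A net that does not depend on `ε` is moderate as soon as its member is smooth on `Ω`. -/
theorem isModerate_const {f : Eu m → ℂ} (hf : ContDiffOn ℝ ∞ f Ω) :
    IsModerate σ Ω fun _ => f := by
  refine ⟨fun _ => hf, fun α K hK hKΩ => ?_⟩
  obtain ⟨C, hC⟩ := hK.exists_bound_of_continuousOn
    ((listDeriv_smooth hf (multiList α)).continuousOn.mono hKΩ)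
  refine ⟨1, one_pos, max C 1, by positivity, ⟨1, by simp⟩, fun ε _ x hx => ?_⟩
  have h1 : (1 : ℝ) ≤ Real.exp (1 * scale σ ε) :=
    Real.one_le_exp (by simpa using scale_nonneg σ ε)
  calc _ ≤ C := hC x hx
    _ ≤ max C 1 * 1 := by simp
    _ ≤ _ := by gcongr

theorem listDeriv_zero (L : List (Fin m)) : listDeriv L (0 : Eu m → ℂ) = 0 := by
  induction L with
  | nil => rfl
  | cons i L ih =>
    have : listDeriv (i :: L) (0 : Eu m → ℂ) = GevreyUltra.pderiv i (listDeriv L 0) := rfl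
    rw [this, ih]
    funext x
    simp [GevreyUltra.pderiv]

theorem isNull_zero : IsNull σ Ω (0 : Net m) := by
  refine ⟨fun _ => contDiffOn_const, fun α K _ _ k _ => ⟨1, one_pos, ⟨1, by simp⟩, ?_⟩⟩
  intro ε _ x _
  have : multiDeriv α ((0 : Net m) ε) x = 0 := by
    show listDeriv (multiList α) (0 : Eu m → ℂ) x = 0
    rw [listDeriv_zero]; rfl
  show ‖multiDeriv α ((0 : Net m) ε) x‖ ≤ _
  rw [this, norm_zero]
  positivity

end helpers

/-! ### The algebra `G^σ(Ω)` -/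

/-- The algebra `E_m^σ(Ω)` of moderate nets. -/
def moderate {m : ℕ} (σ : ℝ) (Ω : TopologicalSpace.Opens (Eu m)) : Subalgebra ℂ (Net m) where
  carrier := {u | IsModerate σ Ω u}
  mul_mem' := IsModerate.mul
  add_mem' := IsModerate.add
  algebraMap_mem' z := isModerate_const (f := fun _ => z) contDiffOn_const

/-- The ideal `N^σ(Ω)` of null nets. -/
def null {m : ℕ} (σ : ℝ) (Ω : TopologicalSpace.Opens (Eu m)) : Ideal (moderate σ Ω) where
  carrier := {u | IsNull σ Ω (u : Net m)}
  add_mem' := IsNull.add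
  zero_mem' := isNull_zero
  smul_mem' u _ hv := IsModerate.mul_null u.2 hv

/-- The algebra `G^σ(Ω) = E_m^σ(Ω) / N^σ(Ω)` of generalized Gevrey ultradistributions. -/
abbrev G {m : ℕ} (σ : ℝ) (Ω : TopologicalSpace.Opens (Eu m)) : Type := moderate σ Ω ⧸ null σ Ω

/-- The class `cl (u_ε)` in `G^σ(Ω)` of a moderate net. -/
def cl {m : ℕ} {σ : ℝ} {Ω : TopologicalSpace.Opens (Eu m)} (u : moderate σ Ω) : G σ Ω :=
  Ideal.Quotient.mk (null σ Ω) u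

/-! ### Gevrey functions -/

/-- `f ∈ E^σ(Ω)`: a function that is of Gevrey class `σ` on `Ω`. -/
def IsGevrey {m : ℕ} (σ : ℝ) (Ω : TopologicalSpace.Opens (Eu m)) (f : Eu m → ℂ) : Prop :=
  ContDiffOn ℝ ∞ f Ω ∧
    ∀ K : Set (Eu m), IsCompact K → K ⊆ Ω → ∃ c > (0 : ℝ), ∀ α : Fin m → ℕ, ∀ x ∈ K,
      ‖multiDeriv α f x‖ ≤ c ^ (multiLength α + 1) * (multiFactorial α : ℝ) ^ σ

/-- `D^σ(Ω)`: the functions of Gevrey class `σ` with compact support contained in `Ω` (extended by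
zero to `ℝᵐ`). -/
def gevreyTest {m : ℕ} (σ : ℝ) (Ω : TopologicalSpace.Opens (Eu m)) : Set (Eu m → ℂ) :=
  {φ | IsGevrey σ Ω φ ∧ HasCompactSupport φ ∧ tsupport φ ⊆ Ω}

/-- The canonical embedding `E^σ(Ω) → G^σ(Ω)` by constant nets. -/
def ofGevrey {m : ℕ} {σ : ℝ} {Ω : TopologicalSpace.Opens (Eu m)} (f : Eu m → ℂ)
    (hf : IsGevrey σ Ω f) : G σ Ω :=
  cl ⟨fun _ => f, isModerate_const hf.1⟩

/-! ### The generalized Gevrey wave front -/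

/-- The Fourier transform `F(h)(ξ) = ∫ exp(-i x·ξ) h(x) dx`. -/
def fourierT {m : ℕ} (h : Eu m → ℂ) (ξ : Eu m) : ℂ :=
  ∫ x : Eu m, Complex.exp (-(Complex.I * ((inner ℝ x ξ : ℝ) : ℂ))) * h x

/-- `Γ` is an open conic neighbourhood of `ξ₀`. -/
def IsConicNhd {m : ℕ} (Γ : Set (Eu m)) (ξ₀ : Eu m) : Prop :=
  IsOpen Γ ∧ ξ₀ ∈ Γ ∧ ∀ t > (0 : ℝ), ∀ ξ ∈ Γ, t • ξ ∈ Γ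

/-- The net has its supports in one compact subset of `Ω`. -/
def HasUniformCompactSupport {m : ℕ} (Ω : TopologicalSpace.Opens (Eu m)) (u : Net m) : Prop :=
  ∃ K : Set (Eu m), IsCompact K ∧ K ⊆ Ω ∧ ∀ ε, ∀ x ∉ K, u ε x = 0

/-- The estimate `|F(u_ε)(ξ)| ≤ c exp(k₁ ε^(-1/(2σ-1)) - k₂ |ξ|^(1/σ))` for `ξ ∈ Γ` and
small `ε`. -/
def FourierDecayOn {m : ℕ} (σ : ℝ) (Γ : Set (Eu m)) (u : Net m) : Prop :=
  ∃ k₁ > (0 : ℝ), ∃ k₂ > (0 : ℝ), ∃ c > (0 : ℝ), ∃ ε₀ : Ioc (0 : ℝ) 1, ∀ ξ ∈ Γ, ∀ ε ≤ ε₀,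
    ‖fourierT (u ε) ξ‖ ≤ c * Real.exp (k₁ * scale σ ε - k₂ * ‖ξ‖ ^ (1 / σ))

/-- The cone `Σ_g^σ(h) ⊆ ℝᵐ \ {0}` of a compactly supported `h ∈ G^σ(Ω)`: the complement of the
directions with a conic neighbourhood on which the Fourier transform of some compactly supported
representative of `h` satisfies the decay estimate. -/
def singCone {m : ℕ} {σ : ℝ} {Ω : TopologicalSpace.Opens (Eu m)} (h : G σ Ω) : Set (Eu m) :=
  {ξ₀ | ξ₀ ≠ 0 ∧ ¬ ∃ Γ : Set (Eu m), IsConicNhd Γ ξ₀ ∧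
    ∃ u : moderate σ Ω, cl u = h ∧ HasUniformCompactSupport Ω (u : Net m) ∧
      FourierDecayOn σ Γ (u : Net m)}

/-- The cone `Σ_{g,x₀}^σ(f) ⊆ ℝᵐ \ {0}` of `σ`-singular directions of `f` at `x₀`: the intersection
of the cones `Σ_g^σ(φ f)` over all `φ ∈ D^σ(Ω)` equal to `1` near `x₀`. -/
def singConeAt {m : ℕ} {σ : ℝ} {Ω : TopologicalSpace.Opens (Eu m)} (f : G σ Ω) (x₀ : Eu m) :
    Set (Eu m) :=
  {ξ | ξ ≠ 0 ∧ ∀ (φ : Eu m → ℂ) (hφ : φ ∈ gevreyTest σ Ω), (∀ᶠ x in 𝓝 x₀, φ x = 1) →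
    ξ ∈ singCone (ofGevrey φ hφ.1 * f)}

/-- The generalized Gevrey wave front `WF_g^σ(f) ⊆ Ω × (ℝᵐ \ {0})`. -/
def WF {m : ℕ} {σ : ℝ} {Ω : TopologicalSpace.Opens (Eu m)} (f : G σ Ω) : Set (Eu m × Eu m) :=
  {p | p.1 ∈ Ω ∧ p.2 ∈ singConeAt f p.1}

/-- The fibrewise sum `{(x, ξ + η) : (x, ξ) ∈ A, (x, η) ∈ B}`. -/
def fiberSum {m : ℕ} (A B : Set (Eu m × Eu m)) : Set (Eu m × Eu m) :=
  {p | ∃ ξ η : Eu m, (p.1, ξ) ∈ A ∧ (p.1, η) ∈ B ∧ p.2 = ξ + η}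

end GevreyUltra

end

/-!
The wave front of a product is read off from the convolution formula
`𝓕 (u v) (ξ) = ∫ 𝓕 u (ξ - η) 𝓕 v (η) dη`. Fix `x₀` and write `A`, `B` for the cones of singular
directions of `f`, `g` at `x₀`. If `ξ₀` lies in none of `A`, `B`, `A + B` and `0 ∉ A + B`, then
`a + b - τ ξ₀` has no nontrivial zero with `a ∈ A ∪ {0}`, `b ∈ B ∪ {0}`, `τ ≥ 0`. By compactness this
is quantitative and survives a fattening of the cones (`exists_le_norm_add_sub_smul`,
`exists_splitting`): for `ξ` near the ray of `ξ₀`, in each splitting `ξ = (ξ - η) + η` one of the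
summands lies outside the corresponding fat cone and has length at least `c₀ |ξ|`. There the
transform decays like `exp (-k |·|^(1/σ))`, while the other factor is bounded by the moderate
quantity `exp (k ε^(-1/(2σ-1)))`. Half of the decay makes the integral converge, the other half is
the decay in `ξ` (`DecayOn.convolution`).

Decay of the Fourier transform depends on the representative, since a null net need not decay
exponentially in `ξ`, so each regular direction of `f` comes with its own representative. They have
to be merged into one that decays outside the whole fat cone. First each is multiplied by a Gevrey
cutoff `ψ` of small support. This keeps the decay on a smaller cone, by the convolution estimate and
the decay of `𝓕 ψ` (`decayOn_fourier_constNet_mul`, `exists_fourier_gevreyTest_le`), and makes all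
of them representatives of `ψ f`. Then their Fourier transforms, finitely many by compactness of the
sphere, are patched together along cones (`exists_glued`). Two representatives of `ψ f` have Fourier
transforms that differ by a net which is null with respect to all polynomial weights, and cutting
such a net along any measurable set keeps it null. Hence the inverse Fourier transform of the
patched net again represents `ψ f` (`exists_spectral_representative`).

Existence of Gevrey cutoffs is never proved, and for `σ = 1` and `m ≥ 1` it fails: regularity of
`ξ₀` for `f` provides one cutoff at `x₀`, and homotheties shrink it into any neighbourhood.
-/

open scoped FourierTransform

namespace GevreyUltra

variable {m : ℕ}

/-! ### Fourier transforms of rapidly decreasing functions -/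

theorem fourierT_eq_fourier (h : Eu m → ℂ) (ξ : Eu m) :
    fourierT h ξ = 𝓕 h ((2 * Real.pi)⁻¹ • ξ) := by
  rw [Real.fourier_eq', fourierT]
  congr 1
  funext x
  rw [smul_eq_mul, inner_smul_right]
  congr 2
  have : -2 * Real.pi * ((2 * Real.pi)⁻¹ * inner ℝ x ξ) = - inner ℝ x ξ := by
    field_simp
  rw [this]
  push_cast
  ring

/-- The function `U` is measurable and decreases faster than any power of the norm. -/
def RapidDecay (U : Eu m → ℂ) : Prop :=
  AEStronglyMeasurable U ∧ ∀ N : ℕ, ∃ C : ℝ, ∀ η, (1 + ‖η‖) ^ N * ‖U η‖ ≤ C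

theorem integrable_weight (m : ℕ) : Integrable fun η : Eu m => ((1 + ‖η‖) ^ (m + 1))⁻¹ := by
  have := integrable_one_add_norm (E := Eu m) (μ := volume) (r := (m + 1 : ℕ))
    (by simp)
  refine this.congr (Eventually.of_forall fun η => ?_)
  show (1 + ‖η‖) ^ (-((m + 1 : ℕ) : ℝ)) = _
  rw [Real.rpow_neg (by positivity), Real.rpow_natCast]

theorem norm_le_weight {U : Eu m → ℂ} {n : ℕ} {B : ℝ}
    (hB : ∀ η, (1 + ‖η‖) ^ (n + (m + 1)) * ‖U η‖ ≤ B) (η : Eu m) :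
    ‖η‖ ^ n * ‖U η‖ ≤ B * ((1 + ‖η‖) ^ (m + 1))⁻¹ := by
  rw [← div_eq_mul_inv, le_div_iff₀ (by positivity)]
  refine le_trans ?_ (hB η)
  have : ‖η‖ ^ n ≤ (1 + ‖η‖) ^ n := by gcongr; linarith
  calc ‖η‖ ^ n * ‖U η‖ * (1 + ‖η‖) ^ (m + 1)
      ≤ (1 + ‖η‖) ^ n * ‖U η‖ * (1 + ‖η‖) ^ (m + 1) := by gcongr
    _ = _ := by ring

theorem integrable_pow_mul {U : Eu m → ℂ} (hU : AEStronglyMeasurable U) {n : ℕ} {B : ℝ}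
    (hB : ∀ η, (1 + ‖η‖) ^ (n + (m + 1)) * ‖U η‖ ≤ B) :
    Integrable fun η => ‖η‖ ^ n * ‖U η‖ := by
  refine ((integrable_weight m).const_mul B).mono'
    ((continuous_norm.pow n).aestronglyMeasurable.mul hU.norm)
    (Eventually.of_forall fun η => ?_)
  rw [Real.norm_of_nonneg (by positivity)]
  exact norm_le_weight hB η

namespace RapidDecay

variable {U V : Eu m → ℂ}

theorem integrable_pow (hU : RapidDecay U) (n : ℕ) : Integrable fun η => ‖η‖ ^ n * ‖U η‖ := by
  obtain ⟨C, hC⟩ := hU.2 (n + (m + 1))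
  exact integrable_pow_mul hU.1 hC

theorem integrable (hU : RapidDecay U) : Integrable U :=
  (integrable_norm_iff hU.1).1 (by simpa using hU.integrable_pow 0)

theorem sub (hU : RapidDecay U) (hV : RapidDecay V) : RapidDecay (U - V) := by
  refine ⟨hU.1.sub hV.1, fun N => ?_⟩
  obtain ⟨C, hC⟩ := hU.2 N
  obtain ⟨D, hD⟩ := hV.2 N
  refine ⟨C + D, fun η => ?_⟩
  calc (1 + ‖η‖) ^ N * ‖(U - V) η‖ ≤ (1 + ‖η‖) ^ N * (‖U η‖ + ‖V η‖) := by
        gcongr; exact norm_sub_le _ _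
    _ ≤ C + D := by rw [mul_add]; exact add_le_add (hC η) (hD η)

open Classical in
theorem piecewise (hU : RapidDecay U) (hV : RapidDecay V) {S : Set (Eu m)}
    (hS : MeasurableSet S) : RapidDecay (S.piecewise U V) := by
  refine ⟨AEStronglyMeasurable.piecewise hS hU.1.restrict hV.1.restrict, fun N => ?_⟩
  obtain ⟨C, hC⟩ := hU.2 N
  obtain ⟨D, hD⟩ := hV.2 N
  refine ⟨max C D, fun η => ?_⟩
  by_cases h : η ∈ S
  · rw [piecewise_eq_of_mem _ _ _ h]; exact (hC η).trans (le_max_left _ _)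
  · rw [piecewise_eq_of_notMem _ _ _ h]; exact (hD η).trans (le_max_right _ _)

/-- The Fourier multiplier of `∂ᵢ` preserves rapid decrease. -/
theorem coord_mul (hU : RapidDecay U) (i : Fin m) :
    RapidDecay fun η => (2 * Real.pi * Complex.I * (η i : ℂ)) * U η := by
  refine ⟨AEStronglyMeasurable.mul (Continuous.aestronglyMeasurable (by fun_prop)) hU.1,
    fun N => ?_⟩
  obtain ⟨C, hC⟩ := hU.2 (N + 1)
  refine ⟨2 * Real.pi * C, fun η => ?_⟩
  have h1 : ‖η i‖ ≤ ‖η‖ := PiLp.norm_apply_le η i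
  have e : ‖(2 * Real.pi * Complex.I * (η i : ℂ)) * U η‖ = 2 * Real.pi * (‖η i‖ * ‖U η‖) := by
    simp [abs_of_pos Real.pi_pos, mul_assoc]
  rw [e]
  calc (1 + ‖η‖) ^ N * (2 * Real.pi * (‖η i‖ * ‖U η‖))
      ≤ (1 + ‖η‖) ^ N * (2 * Real.pi * ((1 + ‖η‖) * ‖U η‖)) := by gcongr; linarith
    _ = 2 * Real.pi * ((1 + ‖η‖) ^ (N + 1) * ‖U η‖) := by ring
    _ ≤ _ := by gcongr; exact hC η

theorem contDiff_fourierInv (hU : RapidDecay U) : ContDiff ℝ ∞ (𝓕⁻ U) := by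
  have h : ContDiff ℝ ∞ (𝓕 U) := Real.contDiff_fourier fun n _ => hU.integrable_pow n
  have : 𝓕⁻ U = fun x => 𝓕 U (-x) := funext fun x => Real.fourierInv_eq_fourier_neg U x
  rw [this]
  exact h.comp contDiff_neg

theorem pderiv_fourierInv (hU : RapidDecay U) (i : Fin m) :
    GevreyUltra.pderiv i (𝓕⁻ U) =
      𝓕⁻ (fun η => (2 * Real.pi * Complex.I * (η i : ℂ)) * U η) := by
  have h1 : Integrable fun v => ‖v‖ * ‖U v‖ := by simpa using hU.integrable_pow 1
  have hI : Integrable (VectorFourier.fourierSMulRight (innerSL ℝ) U) := by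
    refine (h1.const_mul (2 * Real.pi * ‖innerSL ℝ (E := Eu m)‖)).mono'
      (AEStronglyMeasurable.fourierSMulRight hU.1) (Eventually.of_forall fun v => ?_)
    exact (VectorFourier.norm_fourierSMulRight_le _ _ _).trans (by rw [mul_assoc])
  funext x
  have e : 𝓕⁻ U = fun x => 𝓕 U (-x) := funext fun x => Real.fourierInv_eq_fourier_neg U x
  have hd : HasFDerivAt (𝓕⁻ U)
      ((𝓕 (VectorFourier.fourierSMulRight (innerSL ℝ) U) (-x)).comp
        (-(ContinuousLinearMap.id ℝ (Eu m)))) x := by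
    rw [e]
    exact (Real.hasFDerivAt_fourier hU.integrable h1 (-x)).comp x (hasFDerivAt_id x).neg
  rw [GevreyUltra.pderiv, hd.fderiv, Real.fourierInv_eq_fourier_neg]
  simp only [ContinuousLinearMap.comp_apply, _root_.neg_apply,
    ContinuousLinearMap.id_apply, map_neg]
  rw [Real.fourier_continuousLinearMap_apply hI, Real.fourier_eq, Real.fourier_eq,
    ← integral_neg]
  congr 1
  funext v
  rw [VectorFourier.fourierSMulRight_apply, ← smul_neg]
  congr 1
  have : innerSL ℝ v (EuclideanSpace.single i (1 : ℝ)) = v i := by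
    rw [innerSL_apply_apply, EuclideanSpace.inner_single_right]; simp
  rw [this]
  simp
  ring

end RapidDecay

/-- Weighted bounds of `U` control the derivatives of its inverse Fourier transform. -/
theorem exists_listDeriv_fourierInv_le (L : List (Fin m)) :
    ∃ C > (0 : ℝ), ∀ U : Eu m → ℂ, RapidDecay U → ∀ B : ℝ,
      (∀ η, (1 + ‖η‖) ^ (L.length + (m + 1)) * ‖U η‖ ≤ B) →
        ∀ x, ‖listDeriv L (𝓕⁻ U) x‖ ≤ C * B := by
  induction L using List.reverseRecOn with
  | nil =>
    refine ⟨(∫ η : Eu m, ((1 + ‖η‖) ^ (m + 1))⁻¹) + 1, by positivity, fun U hU B hB x => ?_⟩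
    have hB0 : 0 ≤ B := le_trans (by positivity) (hB 0)
    show ‖𝓕⁻ U x‖ ≤ _
    rw [Real.fourierInv_eq]
    calc ‖∫ v, _‖ ≤ ∫ η : Eu m, B * ((1 + ‖η‖) ^ (m + 1))⁻¹ := by
          refine norm_integral_le_of_norm_le ((integrable_weight m).const_mul B)
            (Eventually.of_forall fun η => ?_)
          have := norm_le_weight (n := 0) hB η
          simpa [Circle.norm_smul] using this
      _ ≤ _ := by rw [integral_const_mul]; nlinarith
  | append_singleton L i ih =>
    obtain ⟨C, hC, H⟩ := ih
    refine ⟨C * (2 * Real.pi), by positivity, fun U hU B hB x => ?_⟩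
    rw [listDeriv_append]
    show ‖listDeriv L (pderiv i (𝓕⁻ U)) x‖ ≤ _
    rw [hU.pderiv_fourierInv i, mul_assoc C]
    refine H _ (hU.coord_mul i) _ (fun η => ?_) x
    have h1 : ‖η i‖ ≤ ‖η‖ := PiLp.norm_apply_le η i
    have e : ‖(2 * Real.pi * Complex.I * (η i : ℂ)) * U η‖
        = 2 * Real.pi * (‖η i‖ * ‖U η‖) := by
      simp [abs_of_pos Real.pi_pos, mul_assoc]
    rw [e]
    have h2 := hB η
    rw [List.length_append, List.length_singleton] at h2
    calc (1 + ‖η‖) ^ (L.length + (m + 1)) * (2 * Real.pi * (‖η i‖ * ‖U η‖))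
        ≤ (1 + ‖η‖) ^ (L.length + (m + 1)) * (2 * Real.pi * ((1 + ‖η‖) * ‖U η‖)) := by
          gcongr; linarith
      _ = 2 * Real.pi * ((1 + ‖η‖) ^ (L.length + 1 + (m + 1)) * ‖U η‖) := by ring
      _ ≤ _ := by gcongr

/-! ### Fourier transforms of compactly supported smooth functions -/

section support

variable {Ω : TopologicalSpace.Opens (Eu m)} {K : Set (Eu m)} {u : Eu m → ℂ}

theorem tsupport_subset_of_eq_zero (hK : IsCompact K) (hu : ∀ x ∉ K, u x = 0) :
    tsupport u ⊆ K :=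
  closure_minimal (fun x hx => by_contra fun h => hx (hu x h)) hK.isClosed

theorem contDiff_of_eq_zero_off (hK : IsCompact K) (hKΩ : K ⊆ Ω) (hs : ContDiffOn ℝ ∞ u Ω)
    (hu : ∀ x ∉ K, u x = 0) : ContDiff ℝ ∞ u := by
  rw [contDiff_iff_contDiffAt]
  intro x
  by_cases hx : x ∈ Ω
  · exact hs.contDiffAt (Ω.isOpen.mem_nhds hx)
  · have : u =ᶠ[𝓝 x] fun _ => 0 := by
      filter_upwards [hK.isClosed.isOpen_compl.mem_nhds fun h => hx (hKΩ h)] with y hy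
      exact hu y hy
    exact contDiffAt_const.congr_of_eventuallyEq this

theorem listDeriv_eq_zero_off (hK : IsCompact K) (hu : ∀ x ∉ K, u x = 0) (L : List (Fin m)) :
    ∀ x ∉ K, listDeriv L u x = 0 := by
  intro x hx
  have := listDeriv_congr (Ω := ⟨Kᶜ, hK.isClosed.isOpen_compl⟩) (f := u) (g := 0)
    (fun y hy => hu y hy) L hx
  rw [this, listDeriv_zero]
  rfl

theorem contDiff_pderiv (hs : ContDiff ℝ ∞ u) (i : Fin m) : ContDiff ℝ ∞ (pderiv i u) := by
  have := pderiv_smooth (Ω := ⊤) hs.contDiffOn i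
  simpa [contDiffOn_univ] using this

theorem contDiff_listDeriv (hs : ContDiff ℝ ∞ u) (L : List (Fin m)) :
    ContDiff ℝ ∞ (listDeriv L u) := by
  have := listDeriv_smooth (Ω := ⊤) hs.contDiffOn L
  simpa [contDiffOn_univ] using this

theorem hasCompactSupport_of_eq_zero_off (hK : IsCompact K) (hu : ∀ x ∉ K, u x = 0) :
    HasCompactSupport u :=
  HasCompactSupport.intro hK hu

theorem integrable_of_eq_zero_off (hK : IsCompact K) (hs : ContDiff ℝ ∞ u)
    (hu : ∀ x ∉ K, u x = 0) : Integrable u :=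
  hs.continuous.integrable_of_hasCompactSupport (hasCompactSupport_of_eq_zero_off hK hu)

theorem norm_fourier_le_integral (u : Eu m → ℂ) (ξ : Eu m) : ‖𝓕 u ξ‖ ≤ ∫ x, ‖u x‖ :=
  VectorFourier.norm_fourierIntegral_le_integral_norm _ _ _ _ _

theorem norm_fourier_le_of_eq_zero_off (hK : IsCompact K) (hu : ∀ x ∉ K, u x = 0) {B : ℝ}
    (hB : ∀ x, ‖u x‖ ≤ B) (ξ : Eu m) : ‖𝓕 u ξ‖ ≤ volume.real K * B := by
  refine (norm_fourier_le_integral u ξ).trans ?_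
  have e : ∫ x, ‖u x‖ = ∫ x in K, ‖u x‖ :=
    (setIntegral_eq_integral_of_forall_compl_eq_zero fun x hx => by simp [hu x hx]).symm
  rw [e]
  have h := norm_setIntegral_le_of_norm_le_const (μ := volume) (f := fun x => ‖u x‖) (C := B)
    hK.measure_lt_top (fun x _ => by simpa using hB x)
  rw [mul_comm]
  exact (le_abs_self _).trans h

theorem fourier_pderiv (hK : IsCompact K) (hs : ContDiff ℝ ∞ u) (hu : ∀ x ∉ K, u x = 0)
    (i : Fin m) (ξ : Eu m) :
    𝓕 (pderiv i u) ξ = (2 * Real.pi * Complex.I * (ξ i : ℂ)) * 𝓕 u ξ := by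
  have hc := hasCompactSupport_of_eq_zero_off hK hu
  have hI : Integrable (fderiv ℝ u) :=
    (hs.continuous_fderiv (by simp)).integrable_of_hasCompactSupport (hc.fderiv ℝ)
  have h := Real.fourier_fderiv (integrable_of_eq_zero_off hK hs hu)
    (hs.differentiable (by simp)) hI
  have h2 := Real.fourier_continuousLinearMap_apply (a := EuclideanSpace.single i (1 : ℝ))
    (v := ξ) hI
  show 𝓕 (fun x => fderiv ℝ u x (EuclideanSpace.single i 1)) ξ = _
  rw [← h2, h, VectorFourier.fourierSMulRight_apply]
  have e : innerSL ℝ ξ (EuclideanSpace.single i (1 : ℝ)) = ξ i := by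
    rw [innerSL_apply_apply, EuclideanSpace.inner_single_right]; simp
  rw [_root_.neg_apply, _root_.neg_apply, e]
  simp
  ring

theorem norm_fourier_pderiv (hK : IsCompact K) (hs : ContDiff ℝ ∞ u) (hu : ∀ x ∉ K, u x = 0)
    (i : Fin m) (ξ : Eu m) :
    ‖𝓕 (pderiv i u) ξ‖ = 2 * Real.pi * ‖ξ i‖ * ‖𝓕 u ξ‖ := by
  rw [fourier_pderiv hK hs hu]
  simp [abs_of_pos Real.pi_pos]

theorem norm_le_sum_coord (ξ : Eu m) : ‖ξ‖ ≤ ∑ i, ‖ξ i‖ := by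
  conv_lhs => rw [← (EuclideanSpace.basisFun (Fin m) ℝ).sum_repr ξ]
  refine (norm_sum_le _ _).trans (Finset.sum_le_sum fun i _ => ?_)
  simp [norm_smul]

/-- Bounds of the derivatives of order at most `N` of a function supported in `K` give a decay
of order `N` of its Fourier transform. -/
theorem exists_fourier_le (hK : IsCompact K) (N : ℕ) :
    ∃ C > (0 : ℝ), ∀ u : Eu m → ℂ, ContDiff ℝ ∞ u → (∀ x ∉ K, u x = 0) → ∀ B : ℝ,
      (∀ L : List (Fin m), L.length ≤ N → ∀ x, ‖listDeriv L u x‖ ≤ B) →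
        ∀ ξ, (1 + ‖ξ‖) ^ N * ‖𝓕 u ξ‖ ≤ C * B := by
  induction N with
  | zero =>
    refine ⟨volume.real K + 1, by positivity, fun u hs hu B hB ξ => ?_⟩
    have h0 : ∀ x, ‖u x‖ ≤ B := fun x => hB [] le_rfl x
    have hB0 : 0 ≤ B := (norm_nonneg _).trans (h0 0)
    have := norm_fourier_le_of_eq_zero_off hK hu h0 ξ
    rw [pow_zero, one_mul]
    nlinarith
  | succ N ih =>
    obtain ⟨C, hC, H⟩ := ih
    refine ⟨(1 + m) * C, by positivity, fun u hs hu B hB ξ => ?_⟩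
    have h0 := H u hs hu B (fun L hL => hB L (hL.trans (Nat.le_succ N))) ξ
    have hi : ∀ i : Fin m, (1 + ‖ξ‖) ^ N * (‖ξ i‖ * ‖𝓕 u ξ‖) ≤ C * B := by
      intro i
      have h1 := H (pderiv i u) (contDiff_pderiv hs i)
        (fun x hx => listDeriv_eq_zero_off hK hu [i] x hx) B (fun L hL x => by
          have := hB (L ++ [i]) (by simpa using hL) x
          rwa [listDeriv_append] at this) ξ
      rw [norm_fourier_pderiv hK hs hu] at h1
      refine le_trans ?_ h1
      have h2 : (1 : ℝ) ≤ 2 * Real.pi := by linarith [Real.pi_gt_three]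
      gcongr
      nlinarith [norm_nonneg (ξ i)]
    calc (1 + ‖ξ‖) ^ (N + 1) * ‖𝓕 u ξ‖
        = (1 + ‖ξ‖) ^ N * ‖𝓕 u ξ‖ + (1 + ‖ξ‖) ^ N * (‖ξ‖ * ‖𝓕 u ξ‖) := by ring
      _ ≤ (1 + ‖ξ‖) ^ N * ‖𝓕 u ξ‖ + (1 + ‖ξ‖) ^ N * ((∑ i, ‖ξ i‖) * ‖𝓕 u ξ‖) := by
          gcongr; exact norm_le_sum_coord ξ
      _ = (1 + ‖ξ‖) ^ N * ‖𝓕 u ξ‖ + ∑ i, (1 + ‖ξ‖) ^ N * (‖ξ i‖ * ‖𝓕 u ξ‖) := by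
          rw [Finset.sum_mul, Finset.mul_sum]
      _ ≤ C * B + ∑ _i : Fin m, C * B := add_le_add h0 (Finset.sum_le_sum fun i _ => hi i)
      _ = _ := by simp; ring

theorem continuous_fourier_of_integrable (hu : Integrable u) : Continuous (𝓕 u) :=
  VectorFourier.fourierIntegral_continuous Real.continuous_fourierChar
    (by exact continuous_inner) hu

theorem exists_norm_listDeriv_le (hK : IsCompact K) (hs : ContDiff ℝ ∞ u)
    (hu : ∀ x ∉ K, u x = 0) (L : List (Fin m)) : ∃ B, ∀ x, ‖listDeriv L u x‖ ≤ B := by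
  obtain ⟨B, hB⟩ := hK.exists_bound_of_continuousOn (contDiff_listDeriv hs L).continuous.continuousOn
  refine ⟨max B 0, fun x => ?_⟩
  by_cases hx : x ∈ K
  · exact (hB x hx).trans (le_max_left _ _)
  · simp [listDeriv_eq_zero_off hK hu L x hx]

theorem rapidDecay_fourier (hK : IsCompact K) (hs : ContDiff ℝ ∞ u) (hu : ∀ x ∉ K, u x = 0) :
    RapidDecay (𝓕 u) := by
  refine ⟨(continuous_fourier_of_integrable
    (integrable_of_eq_zero_off hK hs hu)).aestronglyMeasurable, fun N => ?_⟩
  obtain ⟨C, _, H⟩ := exists_fourier_le hK N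
  choose B hB using exists_norm_listDeriv_le hK hs hu
  have hfin := List.finite_length_le (Fin m) N
  obtain ⟨M, hM⟩ := (hfin.image B).bddAbove
  exact ⟨C * M, H u hs hu M fun L hL x => (hB L x).trans (hM ⟨L, hL, rfl⟩)⟩

theorem fourierInv_fourier_of_eq_zero_off (hK : IsCompact K) (hs : ContDiff ℝ ∞ u)
    (hu : ∀ x ∉ K, u x = 0) : 𝓕⁻ (𝓕 u) = u :=
  hs.continuous.fourierInv_fourier_eq (integrable_of_eq_zero_off hK hs hu)
    (rapidDecay_fourier hK hs hu).integrable

end support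

/-- The Fourier transform of a product is the convolution of the Fourier transforms. -/
theorem fourier_mul_fourierInv {v U : Eu m → ℂ} (hv : Integrable v) (hU : Integrable U)
    (ξ : Eu m) : 𝓕 (v * 𝓕⁻ U) ξ = ∫ η, 𝓕 v (ξ - η) * U η := by
  -- The integrand to which Fubini's theorem applies.
  let k : Eu m → Eu m → ℂ := fun x η =>
    (Real.fourierChar (-inner ℝ x (ξ - η)) : ℂ) * (v x * U η)
  have hk : Integrable (Function.uncurry k) (volume.prod volume) := by
    refine (hv.mul_prod hU).bdd_mul (c := 1) ?_ (Eventually.of_forall fun z => ?_)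
    · refine Continuous.aestronglyMeasurable ?_
      exact continuous_subtype_val.comp (Real.continuous_fourierChar.comp (by fun_prop))
    · exact (Circle.norm_coe _).le
  have h1 : 𝓕 (v * 𝓕⁻ U) ξ = ∫ x, ∫ η, k x η := by
    rw [Real.fourier_eq]
    congr 1
    funext x
    simp only [Pi.mul_apply, Circle.smul_def, smul_eq_mul]
    rw [Real.fourierInv_eq, ← mul_assoc, ← integral_const_mul]
    congr 1
    funext η
    simp only [k]
    rw [Circle.smul_def, smul_eq_mul]
    rw [inner_sub_right, show -(inner ℝ x ξ - inner ℝ x η) = -inner ℝ x ξ + inner ℝ x η by ring,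
      AddChar.map_add_eq_mul, Circle.coe_mul, real_inner_comm x η]
    ring
  rw [h1, integral_integral_swap hk]
  congr 1
  funext η
  rw [Real.fourier_eq, ← integral_mul_const]
  congr 1
  funext x
  simp only [k, Circle.smul_def, smul_eq_mul]
  ring

variable {σ : ℝ}

/-! ### Moderate and null nets on the Fourier side -/

/-- The bound `F_ε ≤ c exp(k ε^(-1/(2σ-1)))`, uniform in the index, for small `ε`. -/
def ExpBdd {ι : Type*} (σ k : ℝ) (F : Ioc (0 : ℝ) 1 → ι → ℝ) : Prop :=
  ∃ c > (0 : ℝ), ∃ ε₀ : Ioc (0 : ℝ) 1, ∀ ε ≤ ε₀, ∀ i, F ε i ≤ c * Real.exp (k * scale σ ε)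

namespace ExpBdd

variable {ι : Type*} {k k' : ℝ} {F F' : Ioc (0 : ℝ) 1 → ι → ℝ}

theorem mono (h : ExpBdd σ k F) (hk : k ≤ k') : ExpBdd σ k' F := by
  obtain ⟨c, hc, ε₀, H⟩ := h
  refine ⟨c, hc, ε₀, fun ε hε i => (H ε hε i).trans ?_⟩
  have := scale_nonneg σ ε
  gcongr

theorem add (h : ExpBdd σ k F) (h' : ExpBdd σ k F') :
    ExpBdd σ k fun ε i => F ε i + F' ε i := by
  obtain ⟨c, hc, ε₀, H⟩ := h
  obtain ⟨c', hc', ε₀', H'⟩ := h'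
  refine ⟨c + c', by positivity, min ε₀ ε₀', fun ε hε i => ?_⟩
  rw [add_mul]
  exact add_le_add (H ε (hε.trans (min_le_left _ _)) i) (H' ε (hε.trans (min_le_right _ _)) i)

theorem of_le (h : ExpBdd σ k F) (hF : ∀ ε i, F' ε i ≤ F ε i) : ExpBdd σ k F' := by
  obtain ⟨c, hc, ε₀, H⟩ := h
  exact ⟨c, hc, ε₀, fun ε hε i => (hF ε i).trans (H ε hε i)⟩

/-- Finitely many bounds hold with common constants. -/
theorem finite {κ : Type*} {S : Set κ} (hS : S.Finite) {F : κ → Ioc (0 : ℝ) 1 → ι → ℝ}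
    (h : ∀ j ∈ S, ExpBdd σ k (F j)) :
    ExpBdd σ k fun ε (p : S × ι) => F p.1 ε p.2 := by
  induction S, hS using Set.Finite.induction_on with
  | empty => exact ⟨1, one_pos, ⟨1, by simp⟩, fun _ _ p => p.1.2.elim⟩
  | @insert a S _ _ ih =>
    obtain ⟨c, hc, ε₀, H⟩ := ih fun j hj => h j (mem_insert_of_mem _ hj)
    obtain ⟨c', hc', ε₀', H'⟩ := h a (mem_insert _ _)
    refine ⟨max c c', by positivity, min ε₀ ε₀', ?_⟩
    rintro ε hε ⟨⟨j, hj⟩, i⟩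
    rcases hj with rfl | hj
    · refine (H' ε (hε.trans (min_le_right _ _)) i).trans ?_
      gcongr
      exact le_max_right _ _
    · refine (H ε (hε.trans (min_le_left _ _)) ⟨⟨j, hj⟩, i⟩).trans ?_
      gcongr
      exact le_max_left _ _

theorem exists_finite {κ : Type*} {S : Set κ} (hS : S.Finite) {F : κ → Ioc (0 : ℝ) 1 → ι → ℝ}
    (h : ∀ j ∈ S, ∃ k, ExpBdd σ k (F j)) :
    ∃ k, ExpBdd σ k fun ε (p : S × ι) => F p.1 ε p.2 := by
  choose! k hk using h
  obtain ⟨M, hM⟩ := (hS.image k).bddAbove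
  exact ⟨M, finite hS fun j hj => (hk j hj).mono (hM ⟨j, hj, rfl⟩)⟩

end ExpBdd

/-- The weighted absolute values `(1 + |η|)^N |U_ε(η)|`. -/
noncomputable def weighted (N : ℕ) (U : Net m) : Ioc (0 : ℝ) 1 → Eu m → ℝ :=
  fun ε η => (1 + ‖η‖) ^ N * ‖U ε η‖

/-- Nets of rapidly decreasing functions all of whose weighted suprema are moderate. -/
def RapidMod (σ : ℝ) (U : Net m) : Prop :=
  (∀ ε, RapidDecay (U ε)) ∧ ∀ N, ∃ k, ExpBdd σ k (weighted N U)

/-- Nets of rapidly decreasing functions all of whose weighted suprema are null. -/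
def RapidNull (σ : ℝ) (U : Net m) : Prop :=
  (∀ ε, RapidDecay (U ε)) ∧ ∀ N k, ExpBdd σ k (weighted N U)

theorem RapidNull.rapidMod {U : Net m} (hU : RapidNull σ U) : RapidMod σ U :=
  ⟨hU.1, fun N => ⟨0, hU.2 N 0⟩⟩

theorem weighted_sub_le (N : ℕ) (U V : Net m) (ε : Ioc (0 : ℝ) 1) (η : Eu m) :
    weighted N (U - V) ε η ≤ weighted N U ε η + weighted N V ε η := by
  rw [weighted, weighted, weighted, ← mul_add]
  gcongr
  exact norm_sub_le _ _

theorem RapidMod.sub {U V : Net m} (hU : RapidMod σ U) (hV : RapidMod σ V) :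
    RapidMod σ (U - V) := by
  refine ⟨fun ε => (hU.1 ε).sub (hV.1 ε), fun N => ?_⟩
  obtain ⟨k, hk⟩ := hU.2 N
  obtain ⟨l, hl⟩ := hV.2 N
  exact ⟨max k l, ((hk.mono (le_max_left _ _)).add (hl.mono (le_max_right _ _))).of_le
    (weighted_sub_le N U V)⟩

theorem RapidNull.sub {U V : Net m} (hU : RapidNull σ U) (hV : RapidNull σ V) :
    RapidNull σ (U - V) :=
  ⟨fun ε => (hU.1 ε).sub (hV.1 ε), fun N k =>
    ((hU.2 N k).add (hV.2 N k)).of_le (weighted_sub_le N U V)⟩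

open Classical in
/-- Gluing along any measurable set preserves null nets: no smoothness of the cut is needed on
the Fourier side. -/
theorem RapidNull.piecewise {U V : Net m} (hU : RapidNull σ U) (hV : RapidNull σ V)
    {S : Set (Eu m)} (hS : MeasurableSet S) :
    RapidNull σ fun ε => S.piecewise (U ε) (V ε) := by
  refine ⟨fun ε => (hU.1 ε).piecewise (hV.1 ε) hS, fun N k =>
    ((hU.2 N k).add (hV.2 N k)).of_le fun ε η => ?_⟩
  have h1 : 0 ≤ (1 + ‖η‖) ^ N * ‖U ε η‖ := by positivity
  have h2 : 0 ≤ (1 + ‖η‖) ^ N * ‖V ε η‖ := by positivity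
  simp only [weighted]
  by_cases h : η ∈ S
  · rw [piecewise_eq_of_mem _ _ _ h]; linarith
  · rw [piecewise_eq_of_notMem _ _ _ h]; linarith

variable {Ω : TopologicalSpace.Opens (Eu m)}

theorem RapidMod.isModerate {U : Net m} (hU : RapidMod σ U) :
    IsModerate σ Ω fun ε => 𝓕⁻ (U ε) := by
  refine ⟨fun ε => (hU.1 ε).contDiff_fourierInv.contDiffOn, fun α K _ _ => ?_⟩
  obtain ⟨C, hC, H⟩ := exists_listDeriv_fourierInv_le (multiList α)
  obtain ⟨k, hk⟩ := hU.2 ((multiList α).length + (m + 1))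
  obtain ⟨c, hc, ε₀, h⟩ := hk.mono (le_max_left k 1)
  refine ⟨max k 1, by positivity, C * c, by positivity, ε₀, fun ε hε x _ => ?_⟩
  rw [mul_assoc]
  exact H _ (hU.1 ε) _ (h ε hε) x

theorem RapidNull.isNull {U : Net m} (hU : RapidNull σ U) :
    IsNull σ Ω fun ε => 𝓕⁻ (U ε) := by
  refine ⟨fun ε => (hU.1 ε).contDiff_fourierInv.contDiffOn, fun α K _ _ k _ => ?_⟩
  obtain ⟨C, hC, H⟩ := exists_listDeriv_fourierInv_le (multiList α)
  obtain ⟨c, hc, ε₀, h⟩ := hU.2 ((multiList α).length + (m + 1)) (-k)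
  refine ⟨C * c, by positivity, ε₀, fun ε hε x _ => ?_⟩
  rw [mul_assoc, ← neg_mul]
  exact H _ (hU.1 ε) _ (h ε hε) x

section compact

variable {K : Set (Eu m)} {u : Net m}

theorem expBdd_weighted_fourier (hK : IsCompact K) (hs : ∀ ε, ContDiff ℝ ∞ (u ε))
    (hu : ∀ ε, ∀ x ∉ K, u ε x = 0) (N : ℕ) {k : ℝ}
    (h : ExpBdd σ k fun ε (p : {L : List (Fin m) | L.length ≤ N} × Eu m) =>
      ‖listDeriv (p.1 : List (Fin m)) (u ε) p.2‖) :
    ExpBdd σ k (weighted N fun ε => 𝓕 (u ε)) := by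
  obtain ⟨C, hC, H⟩ := exists_fourier_le hK N
  obtain ⟨c, hc, ε₀, h⟩ := h
  refine ⟨C * c, by positivity, ε₀, fun ε hε ξ => ?_⟩
  rw [mul_assoc]
  exact H (u ε) (hs ε) (hu ε) _ (fun L hL x => h ε hε (⟨L, hL⟩, x)) ξ

theorem IsModerate.rapidMod_fourier (hm : IsModerate σ Ω u) (hK : IsCompact K) (hKΩ : K ⊆ Ω)
    (hu : ∀ ε, ∀ x ∉ K, u ε x = 0) : RapidMod σ fun ε => 𝓕 (u ε) := by
  have hs : ∀ ε, ContDiff ℝ ∞ (u ε) := fun ε => contDiff_of_eq_zero_off hK hKΩ (hm.1 ε) (hu ε)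
  refine ⟨fun ε => rapidDecay_fourier hK (hs ε) (hu ε), fun N => ?_⟩
  obtain ⟨k, hk⟩ := ExpBdd.exists_finite (σ := σ) (List.finite_length_le (Fin m) N)
    (F := fun L ε x => ‖listDeriv L (u ε) x‖) (fun L _ => by
      obtain ⟨k, hk, c, hc, ε₀, H⟩ := hm.list L K hK hKΩ
      refine ⟨k, c, hc, ε₀, fun ε hε x => ?_⟩
      by_cases hx : x ∈ K
      · exact H ε hε x hx
      · simp only [listDeriv_eq_zero_off hK (hu ε) L x hx, norm_zero]; positivity)
  exact ⟨k, expBdd_weighted_fourier hK hs hu N hk⟩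

theorem IsNull.rapidNull_fourier (hm : IsNull σ Ω u) (hK : IsCompact K) (hKΩ : K ⊆ Ω)
    (hu : ∀ ε, ∀ x ∉ K, u ε x = 0) : RapidNull σ fun ε => 𝓕 (u ε) := by
  have hs : ∀ ε, ContDiff ℝ ∞ (u ε) := fun ε => contDiff_of_eq_zero_off hK hKΩ (hm.1 ε) (hu ε)
  refine ⟨fun ε => rapidDecay_fourier hK (hs ε) (hu ε), fun N k => ?_⟩
  refine expBdd_weighted_fourier hK hs hu N (ExpBdd.finite (List.finite_length_le (Fin m) N)
    (F := fun L ε x => ‖listDeriv L (u ε) x‖) fun L _ => ?_)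
  suffices h : ExpBdd σ (-(|k| + 1)) fun ε x => ‖listDeriv L (u ε) x‖ from
    h.mono (by linarith [neg_abs_le k])
  obtain ⟨c, hc, ε₀, H⟩ := hm.list L K hK hKΩ (|k| + 1) (by positivity)
  refine ⟨c, hc, ε₀, fun ε hε x => ?_⟩
  rw [neg_mul]
  by_cases hx : x ∈ K
  · exact H ε hε x hx
  · simp only [listDeriv_eq_zero_off hK (hu ε) L x hx, norm_zero]; positivity

end compact

/-! ### Gevrey cutoff functions -/

theorem length_multiList (α : Fin m → ℕ) : (multiList α).length = multiLength α := by
  rw [multiList, List.length_flatMap, multiLength]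
  simp only [List.length_replicate]
  rw [← List.ofFn_eq_map, List.sum_ofFn]

variable {φ : Eu m → ℂ}

theorem eq_zero_off_tsupport : ∀ x ∉ tsupport φ, φ x = 0 :=
  fun _ hx => image_eq_zero_of_notMem_tsupport hx

theorem contDiff_of_mem_gevreyTest (hφ : φ ∈ gevreyTest σ Ω) : ContDiff ℝ ∞ φ :=
  contDiff_of_eq_zero_off hφ.2.1 hφ.2.2 hφ.1.1 eq_zero_off_tsupport

/-- The Gevrey estimates of a test function hold with one constant on the whole space. -/
theorem exists_gevrey_bound (hφ : φ ∈ gevreyTest σ Ω) :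
    ∃ c > (0 : ℝ), ∀ (α : Fin m → ℕ) (x : Eu m),
      ‖multiDeriv α φ x‖ ≤ c ^ (multiLength α + 1) * (multiFactorial α : ℝ) ^ σ := by
  obtain ⟨c, hc, H⟩ := hφ.1.2 _ hφ.2.1 hφ.2.2
  refine ⟨c, hc, fun α x => ?_⟩
  by_cases hx : x ∈ tsupport φ
  · exact H α x hx
  · rw [multiDeriv, listDeriv_eq_zero_off hφ.2.1 eq_zero_off_tsupport _ x hx, norm_zero]
    positivity

theorem listDeriv_comp_homothety (hφ : ContDiff ℝ ∞ φ) (x₀ : Eu m) (t : ℝ) (L : List (Fin m)) :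
    listDeriv L (fun x => φ (x₀ + t • (x - x₀))) =
      fun x => (t : ℂ) ^ L.length * listDeriv L φ (x₀ + t • (x - x₀)) := by
  induction L with
  | nil => simp [listDeriv]
  | cons i L ih =>
    show pderiv i (listDeriv L _) = _
    rw [ih]
    funext x
    have h1 : HasFDerivAt (listDeriv L φ) (fderiv ℝ (listDeriv L φ) (x₀ + t • (x - x₀)))
        (x₀ + t • (x - x₀)) :=
      ((contDiff_listDeriv hφ L).differentiable (by simp) _).hasFDerivAt
    have h2 : HasFDerivAt (fun x : Eu m => x₀ + t • (x - x₀))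
        (t • ContinuousLinearMap.id ℝ (Eu m)) x :=
      (((hasFDerivAt_id x).sub_const x₀).const_smul t).const_add x₀
    have h3 := (h1.comp x h2).const_mul ((t : ℂ) ^ L.length)
    rw [pderiv]
    erw [h3.fderiv]
    show _ = (t : ℂ) ^ (L.length + 1) * fderiv ℝ (listDeriv L φ) _ _
    simp only [_root_.smul_apply, ContinuousLinearMap.comp_apply,
      ContinuousLinearMap.id_apply, map_smul, smul_eq_mul, Complex.real_smul]
    ring

/-- A Gevrey cutoff at `x₀` can be shrunk by a homothety into any neighbourhood of `x₀`. -/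
theorem exists_gevreyTest_tsupport_subset {x₀ : Eu m} (hx₀ : x₀ ∈ Ω) (hφ : φ ∈ gevreyTest σ Ω)
    (h1 : ∀ᶠ x in 𝓝 x₀, φ x = 1) {W : Set (Eu m)} (hW : W ∈ 𝓝 x₀) :
    ∃ ψ ∈ gevreyTest σ Ω, (∀ᶠ x in 𝓝 x₀, ψ x = 1) ∧ tsupport ψ ⊆ W := by
  obtain ⟨r, hr, hrW⟩ := Metric.nhds_basis_closedBall.mem_iff.1
    (inter_mem hW (Ω.isOpen.mem_nhds hx₀))
  obtain ⟨R, hR⟩ := hφ.2.1.isBounded.subset_closedBall x₀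
  -- `t ≥ 1` keeps the Gevrey constant `t * c` valid, and `t * r > R` shrinks the support.
  let t : ℝ := 1 + |R| / r
  have ht : 1 ≤ t := by simp only [t]; linarith [div_nonneg (abs_nonneg R) hr.le]
  let ψ : Eu m → ℂ := fun x => φ (x₀ + t • (x - x₀))
  have hsupp : ∀ x ∉ Metric.closedBall x₀ r, ψ x = 0 := by
    intro x hx
    refine eq_zero_off_tsupport (φ := φ) (x₀ + t • (x - x₀)) fun hmem => ?_
    have h2 := hR hmem
    rw [Metric.mem_closedBall, dist_eq_norm] at h2 hx
    rw [add_sub_cancel_left, norm_smul, Real.norm_of_nonneg (by linarith)] at h2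
    have h3 : t * r ≤ t * ‖x - x₀‖ := by
      have := (not_le.1 hx).le
      gcongr
    have h4 : t * r = r + |R| := by simp only [t]; field_simp
    linarith [le_abs_self R]
  have hts : tsupport ψ ⊆ Metric.closedBall x₀ r :=
    tsupport_subset_of_eq_zero (isCompact_closedBall x₀ r) hsupp
  have hφs := contDiff_of_mem_gevreyTest hφ
  have hψs : ContDiff ℝ ∞ ψ := hφs.comp (by fun_prop)
  obtain ⟨c, hc, H⟩ := exists_gevrey_bound hφ
  refine ⟨ψ, ⟨⟨hψs.contDiffOn, fun K _ _ => ⟨t * c, by positivity, fun α x _ => ?_⟩⟩,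
    hasCompactSupport_of_eq_zero_off (isCompact_closedBall x₀ r) hsupp,
    hts.trans (hrW.trans inter_subset_right)⟩, ?_, hts.trans (hrW.trans inter_subset_left)⟩
  · rw [multiDeriv, listDeriv_comp_homothety hφs, length_multiList]
    have h2 := H α (x₀ + t • (x - x₀))
    rw [multiDeriv] at h2
    rw [norm_mul, norm_pow, Complex.norm_real, Real.norm_of_nonneg (by linarith), mul_pow,
      mul_assoc]
    gcongr
    omega
  · have hcont : Tendsto (fun x : Eu m => x₀ + t • (x - x₀)) (𝓝 x₀) (𝓝 x₀) := by
      have : ContinuousAt (fun x : Eu m => x₀ + t • (x - x₀)) x₀ := by fun_prop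
      simpa [ContinuousAt] using this
    exact hcont.eventually h1

/-- Summing the bounds `rⁿ y ≤ A (n!)^σ` against the exponential series gives exponential
decay in `r^(1/σ)`. -/
theorem le_exp_of_forall_pow_mul_le (hσ : 1 ≤ σ) {r y A : ℝ} (hr : 0 ≤ r) (hy : 0 ≤ y)
    (hA : 0 < A) (h : ∀ n : ℕ, r ^ n * y ≤ A * (n.factorial : ℝ) ^ σ) :
    y ≤ A * 2 ^ σ * Real.exp (-(σ / 2) * r ^ (1 / σ)) := by
  have hσ0 : 0 < σ := by linarith
  set s := r ^ (1 / σ) with hs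
  set X := (y / A) ^ (1 / σ) with hX
  have hs0 : 0 ≤ s := Real.rpow_nonneg hr _
  have hX0 : 0 ≤ X := Real.rpow_nonneg (by positivity) _
  have hpow : ∀ {a : ℝ}, 0 ≤ a → (a ^ (1 / σ)) ^ σ = a := fun ha => by
    rw [← Real.rpow_mul ha, one_div_mul_cancel hσ0.ne', Real.rpow_one]
  have h1 : ∀ n : ℕ, s ^ n * X ≤ n.factorial := by
    intro n
    have h2 : (s ^ n * X) ^ σ ≤ (n.factorial : ℝ) ^ σ := by
      rw [Real.mul_rpow (by positivity) hX0, hX, hpow (by positivity), ← Real.rpow_natCast s,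
        ← Real.rpow_mul hs0, mul_comm (n : ℝ), Real.rpow_mul hs0, hs, hpow hr,
        Real.rpow_natCast, ← mul_div_assoc, div_le_iff₀ hA, mul_comm _ A]
      exact h n
    exact (Real.rpow_le_rpow_iff (by positivity) (by positivity) hσ0).1 h2
  -- `(s / 2)ⁿ / n! * X ≤ 2⁻ⁿ`, summed over `n`.
  have h3 : X * Real.exp (s / 2) ≤ 2 := by
    have e1 : HasSum (fun n : ℕ => X * ((s / 2) ^ n / n.factorial)) (X * Real.exp (s / 2)) := by
      refine HasSum.mul_left X ?_
      have := NormedSpace.exp_series_hasSum_exp' (𝕂 := ℝ) (s / 2)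
      rw [← Real.exp_eq_exp_ℝ] at this
      simpa [div_eq_inv_mul] using this
    refine hasSum_le (fun n => ?_) e1 hasSum_geometric_two
    have hf : (0 : ℝ) < n.factorial := by positivity
    rw [← mul_div_assoc, div_le_iff₀ hf, div_pow, one_div, inv_pow]
    have := h1 n
    rw [← mul_div_assoc, div_eq_inv_mul, mul_comm X]
    gcongr
  have h4 : X ≤ 2 * Real.exp (-(s / 2)) := by
    rw [Real.exp_neg, ← div_eq_mul_inv, le_div_iff₀ (Real.exp_pos _)]
    exact h3
  have h5 : y / A ≤ (2 * Real.exp (-(s / 2))) ^ σ := by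
    rw [← hpow (a := y / A) (by positivity)]
    exact Real.rpow_le_rpow hX0 h4 hσ0.le
  rw [div_le_iff₀ hA, Real.mul_rpow (by norm_num) (Real.exp_pos _).le, ← Real.exp_mul] at h5
  refine h5.trans (le_of_eq ?_)
  rw [show -(s / 2) * σ = -(σ / 2) * s by ring]
  ring

theorem norm_fourier_listDeriv_replicate {K : Set (Eu m)} (hK : IsCompact K)
    (hs : ContDiff ℝ ∞ φ) (hu : ∀ x ∉ K, φ x = 0) (i : Fin m) (n : ℕ) (ξ : Eu m) :
    ‖𝓕 (listDeriv (List.replicate n i) φ) ξ‖ = (2 * Real.pi * ‖ξ i‖) ^ n * ‖𝓕 φ ξ‖ := by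
  induction n with
  | zero => simp [listDeriv]
  | succ n ih =>
    rw [List.replicate_succ]
    show ‖𝓕 (pderiv i (listDeriv (List.replicate n i) φ)) ξ‖ = _
    rw [norm_fourier_pderiv hK (contDiff_listDeriv hs _) (listDeriv_eq_zero_off hK hu _), ih,
      pow_succ]
    ring

theorem exists_norm_le_coord {ξ : Eu m} (hξ : ξ ≠ 0) : ∃ i, ‖ξ‖ ≤ (m + 1) * ‖ξ i‖ := by
  by_contra! h
  have h0 : 0 < ‖ξ‖ := norm_pos_iff.2 hξ
  have h1 : (m + 1) * ‖ξ‖ ≤ m * ‖ξ‖ := by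
    calc (m + 1) * ‖ξ‖ ≤ (m + 1) * ∑ i, ‖ξ i‖ := by gcongr; exact norm_le_sum_coord ξ
      _ = ∑ i, (m + 1) * ‖ξ i‖ := Finset.mul_sum _ _ _
      _ ≤ ∑ _i : Fin m, ‖ξ‖ := Finset.sum_le_sum fun i _ => (h i).le
      _ = _ := by simp
  linarith

/-- The Fourier transform of a Gevrey test function decays like `exp (-κ |ξ|^(1/σ))`. -/
theorem exists_fourier_gevreyTest_le (hσ : 1 ≤ σ) (hφ : φ ∈ gevreyTest σ Ω) :
    ∃ C > (0 : ℝ), ∃ κ > (0 : ℝ), ∀ ξ, ‖𝓕 φ ξ‖ ≤ C * Real.exp (-κ * ‖ξ‖ ^ (1 / σ)) := by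
  have hσ0 : 0 < σ := by linarith
  obtain ⟨c, hc, H⟩ := exists_gevrey_bound hφ
  have hs := contDiff_of_mem_gevreyTest hφ
  set M := volume.real (tsupport φ) with hM
  set A := (M + 1) * c with hA
  have hM0 : 0 ≤ M := measureReal_nonneg
  have hA0 : 0 < A := by positivity
  set b := (m + 1) * c with hb
  have hb0 : 0 < b := by positivity
  have key : ∀ ξ : Eu m, ξ ≠ 0 → ∀ n : ℕ,
      (‖ξ‖ / b) ^ n * ‖𝓕 φ ξ‖ ≤ A * (n.factorial : ℝ) ^ σ := by
    intro ξ hξ n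
    obtain ⟨i, hi⟩ := exists_norm_le_coord hξ
    have h1 : ∀ x, ‖listDeriv (List.replicate n i) φ x‖ ≤ c ^ (n + 1) * (n.factorial : ℝ) ^ σ := by
      intro x
      -- The Gevrey bound is only used for pure derivatives `∂ᵢⁿ`.
      have h2 := H (Pi.single i n) x
      have e1 : multiLength (Pi.single i n : Fin m → ℕ) = n := by
        simp [multiLength]
      have e2 : multiFactorial (Pi.single i n : Fin m → ℕ) = n.factorial := by
        rw [multiFactorial, Finset.prod_eq_single i]
        · simp
        · intro j _ hj; simp [Pi.single_eq_of_ne hj]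
        · simp
      have e3 : (List.replicate n i).Perm (multiList (Pi.single i n : Fin m → ℕ)) := by
        rw [List.perm_iff_count]
        intro j
        rw [multiList_count, List.count_replicate]
        by_cases hj : i = j
        · subst hj; simp
        · simp [hj]
      rw [e1, e2, multiDeriv, ← listDeriv_perm (Ω := ⊤) hs.contDiffOn e3 (mem_univ x)] at h2
      exact h2
    have h3 := norm_fourier_le_of_eq_zero_off hφ.2.1
      (listDeriv_eq_zero_off hφ.2.1 eq_zero_off_tsupport (List.replicate n i)) h1 ξ
    rw [norm_fourier_listDeriv_replicate hφ.2.1 hs eq_zero_off_tsupport] at h3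
    have h4 : ‖ξ‖ ≤ (m + 1) * (2 * Real.pi * ‖ξ i‖) := by
      refine hi.trans ?_
      gcongr
      nlinarith [Real.pi_gt_three, norm_nonneg (ξ i)]
    have h5 : ‖ξ‖ / b ≤ (2 * Real.pi * ‖ξ i‖) / c := by
      rw [hb, div_le_div_iff₀ (by positivity) hc]
      calc ‖ξ‖ * c ≤ (m + 1) * (2 * Real.pi * ‖ξ i‖) * c := by gcongr
        _ = _ := by ring
    calc (‖ξ‖ / b) ^ n * ‖𝓕 φ ξ‖ ≤ ((2 * Real.pi * ‖ξ i‖) / c) ^ n * ‖𝓕 φ ξ‖ := by gcongr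
      _ = ((2 * Real.pi * ‖ξ i‖) ^ n * ‖𝓕 φ ξ‖) / c ^ n := by rw [div_pow]; ring
      _ ≤ (M * (c ^ (n + 1) * (n.factorial : ℝ) ^ σ)) / c ^ n := by gcongr
      _ = M * c * (n.factorial : ℝ) ^ σ := by field_simp; ring
      _ ≤ _ := by rw [hA]; gcongr; linarith
  refine ⟨A * 2 ^ σ + M * c, by positivity, (σ / 2) * (b⁻¹) ^ (1 / σ), by positivity, fun ξ => ?_⟩
  rcases eq_or_ne ξ 0 with rfl | hξ
  · rw [norm_zero, Real.zero_rpow (by positivity), mul_zero, Real.exp_zero, mul_one]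
    have h0 : ∀ x, ‖φ x‖ ≤ c := fun x => by
      have h := H 0 x
      have e : multiList (0 : Fin m → ℕ) = [] := by simp [multiList]
      simpa [multiLength, multiFactorial, multiDeriv, e, listDeriv] using h
    refine (norm_fourier_le_of_eq_zero_off hφ.2.1 eq_zero_off_tsupport h0 0).trans ?_
    have : 0 < A * 2 ^ σ := by positivity
    linarith
  · refine (le_exp_of_forall_pow_mul_le hσ (by positivity) (norm_nonneg _) hA0 (key ξ hξ)).trans ?_
    have e : -(σ / 2) * (‖ξ‖ / b) ^ (1 / σ) = -(σ / 2 * b⁻¹ ^ (1 / σ)) * ‖ξ‖ ^ (1 / σ) := by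
      rw [div_eq_mul_inv ‖ξ‖ b, Real.mul_rpow (norm_nonneg _) (by positivity)]
      ring
    rw [e]
    gcongr
    have : 0 ≤ M * c := by positivity
    linarith

/-! ### The convolution estimate -/

/-- The bound `|U_ε(ξ)| ≤ c exp (k₁ ε^(-1/(2σ-1)) - k₂ |ξ|^(1/σ))` for `ξ ∈ P` and small `ε`; in
contrast to `FourierDecayOn` it is a condition on the frequency side. -/
def DecayOn (σ : ℝ) (P : Set (Eu m)) (U : Net m) : Prop :=
  ∃ k₁ : ℝ, ∃ k₂ > (0 : ℝ), ∃ c > (0 : ℝ), ∃ ε₀ : Ioc (0 : ℝ) 1, ∀ ξ ∈ P, ∀ ε ≤ ε₀,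
    ‖U ε ξ‖ ≤ c * Real.exp (k₁ * scale σ ε - k₂ * ‖ξ‖ ^ (1 / σ))

theorem DecayOn.mono {P Q : Set (Eu m)} {U : Net m} (h : DecayOn σ P U) (hQ : Q ⊆ P) :
    DecayOn σ Q U := by
  obtain ⟨k₁, k₂, hk₂, c, hc, ε₀, H⟩ := h
  exact ⟨k₁, k₂, hk₂, c, hc, ε₀, fun ξ hξ => H ξ (hQ hξ)⟩

theorem decayOn_empty {U : Net m} : DecayOn σ ∅ U :=
  ⟨1, 1, one_pos, 1, one_pos, ⟨1, by simp⟩, fun _ h => h.elim⟩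

theorem DecayOn.union {P Q : Set (Eu m)} {U : Net m} (hP : DecayOn σ P U) (hQ : DecayOn σ Q U) :
    DecayOn σ (P ∪ Q) U := by
  obtain ⟨k₁, k₂, hk₂, c, hc, ε₀, H⟩ := hP
  obtain ⟨l₁, l₂, hl₂, d, hd, δ₀, H'⟩ := hQ
  refine ⟨max k₁ l₁, min k₂ l₂, lt_min hk₂ hl₂, max c d, by positivity, min ε₀ δ₀,
    fun ξ hξ ε hε => ?_⟩
  have hs := scale_nonneg σ ε
  have hn : 0 ≤ ‖ξ‖ ^ (1 / σ) := by positivity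
  rcases hξ with hξ | hξ
  · refine (H ξ hξ ε (hε.trans (min_le_left _ _))).trans ?_
    gcongr
    exacts [le_max_left _ _, le_max_left _ _, min_le_left _ _]
  · refine (H' ξ hξ ε (hε.trans (min_le_right _ _))).trans ?_
    gcongr
    exacts [le_max_right _ _, le_max_right _ _, min_le_right _ _]

theorem DecayOn.congr {P : Set (Eu m)} {U V : Net m} (h : DecayOn σ P U)
    (hUV : ∀ ε, EqOn (U ε) (V ε) P) : DecayOn σ P V := by
  obtain ⟨k₁, k₂, hk₂, c, hc, ε₀, H⟩ := h
  exact ⟨k₁, k₂, hk₂, c, hc, ε₀, fun ξ hξ ε hε => by rw [← hUV ε hξ]; exact H ξ hξ ε hε⟩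

theorem FourierDecayOn.decayOn (hσ : 1 ≤ σ) {Γ : Set (Eu m)} {u : Net m}
    (hΓ : ∀ t > (0 : ℝ), ∀ ξ ∈ Γ, t • ξ ∈ Γ) (h : FourierDecayOn σ Γ u) :
    DecayOn σ Γ fun ε => 𝓕 (u ε) := by
  obtain ⟨k₁, hk₁, k₂, hk₂, c, hc, ε₀, H⟩ := h
  refine ⟨k₁, k₂, hk₂, c, hc, ε₀, fun ξ hξ ε hε => ?_⟩
  have h1 := H _ (hΓ (2 * Real.pi) (by positivity) ξ hξ) ε hε
  rw [fourierT_eq_fourier, smul_smul, inv_mul_cancel₀ (by positivity), one_smul] at h1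
  refine h1.trans ?_
  have h2 : ‖ξ‖ ≤ ‖(2 * Real.pi) • ξ‖ := by
    rw [norm_smul, Real.norm_of_nonneg (by positivity)]
    nlinarith [Real.pi_gt_three, norm_nonneg ξ]
  have hσ0 : 0 ≤ 1 / σ := by positivity
  gcongr

theorem DecayOn.fourierDecayOn {Γ : Set (Eu m)} {u : Net m}
    (hΓ : ∀ t > (0 : ℝ), ∀ ξ ∈ Γ, t • ξ ∈ Γ) (h : DecayOn σ Γ fun ε => 𝓕 (u ε)) :
    FourierDecayOn σ Γ u := by
  obtain ⟨k₁, k₂, hk₂, c, hc, ε₀, H⟩ := h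
  refine ⟨max k₁ 1, by positivity, k₂ * ((2 * Real.pi)⁻¹) ^ (1 / σ), by positivity, c, hc, ε₀,
    fun ξ hξ ε hε => ?_⟩
  rw [fourierT_eq_fourier]
  refine (H _ (hΓ _ (by positivity) ξ hξ) ε hε).trans ?_
  rw [norm_smul, Real.norm_of_nonneg (by positivity),
    Real.mul_rpow (by positivity) (norm_nonneg _), mul_assoc]
  have hs := scale_nonneg σ ε
  gcongr
  exact le_max_left _ _

theorem integrable_exp_neg_norm_rpow {p κ : ℝ} (hp : 0 < p) (hp1 : p ≤ 1) (hκ : 0 < κ) :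
    Integrable fun η : Eu m => Real.exp (-κ * ‖η‖ ^ p) := by
  obtain ⟨n, hn⟩ := exists_nat_ge ((m + 1 : ℕ) / p)
  rw [div_le_iff₀ hp] at hn
  refine ((integrable_weight m).const_mul (Real.exp κ * (n.factorial / κ ^ n))).mono'
    (Continuous.aestronglyMeasurable ?_) (Eventually.of_forall fun η => ?_)
  · have : Continuous fun η : Eu m => ‖η‖ ^ p :=
      continuous_norm.rpow_const fun _ => Or.inr hp.le
    fun_prop
  rw [Real.norm_of_nonneg (Real.exp_pos _).le, ← div_eq_mul_inv, le_div_iff₀ (by positivity)]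
  have h0 : (0 : ℝ) ≤ ‖η‖ := norm_nonneg η
  set y := (1 + ‖η‖) ^ p with hy
  have hy0 : 0 < y := by positivity
  have h1 : y ≤ 1 + ‖η‖ ^ p := by
    simpa using Real.rpow_add_le_add_rpow (zero_le_one) h0 hp.le hp1
  have h2 : (1 + ‖η‖) ^ (m + 1) ≤ y ^ n := by
    rw [hy, ← Real.rpow_natCast, ← Real.rpow_natCast, ← Real.rpow_mul (by positivity)]
    exact Real.rpow_le_rpow_of_exponent_le (by linarith) (by linarith)
  have h3 : y ^ n ≤ n.factorial / κ ^ n * Real.exp (κ * y) := by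
    have := Real.pow_div_factorial_le_exp (κ * y) (by positivity) n
    rw [div_le_iff₀ (by positivity), mul_pow] at this
    rw [div_mul_eq_mul_div, le_div_iff₀ (by positivity)]
    linarith
  calc Real.exp (-κ * ‖η‖ ^ p) * (1 + ‖η‖) ^ (m + 1)
      ≤ Real.exp (-κ * ‖η‖ ^ p) * (n.factorial / κ ^ n * Real.exp (κ * y)) := by
        gcongr; exact h2.trans h3
    _ = (n.factorial / κ ^ n) * Real.exp (-κ * ‖η‖ ^ p + κ * y) := by rw [Real.exp_add]; ring
    _ ≤ (n.factorial / κ ^ n) * Real.exp κ := by gcongr; nlinarith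
    _ = _ := by ring

/-- Half of the decay in `η` pays for integrability, the other half for decay in `ξ`. -/
theorem rpow_split {p κ κ' c₀ a b : ℝ} (hp : 0 ≤ p) (hc₀ : 0 ≤ c₀) (ha : 0 ≤ a)
    (hκ' : 0 ≤ κ') (hκ : 2 * κ' ≤ κ) (hab : c₀ * a ≤ b) :
    κ' * c₀ ^ p * a ^ p + κ' * b ^ p ≤ κ * b ^ p := by
  have h1 : c₀ ^ p * a ^ p ≤ b ^ p := by
    rw [← Real.mul_rpow hc₀ ha]
    exact Real.rpow_le_rpow (by positivity) hab hp
  have hb : 0 ≤ b := le_trans (by positivity) hab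
  have h2 : 0 ≤ b ^ p := Real.rpow_nonneg hb p
  nlinarith [mul_le_mul_of_nonneg_left h1 hκ', mul_le_mul_of_nonneg_right hκ h2]

/-- A convolution decays on `Γ` if, for `ξ ∈ Γ` and every splitting `ξ = (ξ - η) + η`, one of the
factors is evaluated in its region of decay, at a frequency comparable to `ξ` or larger. -/
theorem DecayOn.convolution (hσ : 1 ≤ σ) {U V : Net m} {P Q Γ : Set (Eu m)}
    (hU : DecayOn σ P U) (hV : DecayOn σ Q V)
    (hUb : ∃ k, ExpBdd σ k fun ε η => ‖U ε η‖) (hVb : ∃ k, ExpBdd σ k fun ε η => ‖V ε η‖)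
    {c₀ : ℝ} (hc₀ : 0 < c₀)
    (H : ∀ ξ ∈ Γ, ∀ η, (η ∈ Q ∧ c₀ * ‖ξ‖ ≤ ‖η‖) ∨ (ξ - η ∈ P ∧ c₀ * ‖ξ‖ ≤ ‖ξ - η‖)) :
    DecayOn σ Γ fun ε ξ => ∫ η, U ε (ξ - η) * V ε η := by
  obtain ⟨k, κ, hκ, c, hc, ε₁, hU⟩ := hU
  obtain ⟨l, μ, hμ, d, hd, ε₂, hV⟩ := hV
  obtain ⟨k', c', hc', ε₃, hUb⟩ := hUb
  obtain ⟨l', d', hd', ε₄, hVb⟩ := hVb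
  have hp : 0 < 1 / σ := by positivity
  have hp1 : 1 / σ ≤ 1 := by rw [div_le_one (by linarith)]; exact hσ
  set p := 1 / σ with hpdef
  set κ' := min κ μ / 2 with hκ'
  have hκ'0 : 0 < κ' := by positivity
  have hκ'1 : 2 * κ' ≤ κ := by rw [hκ']; linarith [min_le_left κ μ]
  have hκ'2 : 2 * κ' ≤ μ := by rw [hκ']; linarith [min_le_right κ μ]
  set E : Eu m → ℝ := fun η => Real.exp (-κ' * ‖η‖ ^ p) with hE
  have hEi : Integrable E := integrable_exp_neg_norm_rpow hp hp1 hκ'0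
  have hE0 : ∀ η, 0 < E η := fun η => Real.exp_pos _
  set J := ∫ η, E η with hJ
  have hJ0 : 0 ≤ J := integral_nonneg fun η => (hE0 η).le
  set K := max (k + l') (k' + l) with hK
  set D := c * d' + c' * d with hD
  have hD0 : 0 < D := by positivity
  refine ⟨K, κ' * c₀ ^ p, by positivity, D * (2 * J + 1), by positivity,
    min (min ε₁ ε₂) (min ε₃ ε₄), fun ξ hξ ε hε => ?_⟩
  have hs := scale_nonneg σ ε
  have hε1 : ε ≤ ε₁ := hε.trans ((min_le_left _ _).trans (min_le_left _ _))
  have hε2 : ε ≤ ε₂ := hε.trans ((min_le_left _ _).trans (min_le_right _ _))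
  have hε3 : ε ≤ ε₃ := hε.trans ((min_le_right _ _).trans (min_le_left _ _))
  have hε4 : ε ≤ ε₄ := hε.trans ((min_le_right _ _).trans (min_le_right _ _))
  set s := scale σ ε with hsdef
  set T := D * Real.exp (K * s - κ' * c₀ ^ p * ‖ξ‖ ^ p) with hT
  have hT0 : 0 < T := by positivity
  have hbound : ∀ η, ‖U ε (ξ - η) * V ε η‖ ≤ T * (E η + E (ξ - η)) := by
    intro η
    rw [norm_mul]
    rcases H ξ hξ η with ⟨hη, hle⟩ | ⟨hη, hle⟩
    · have h1 := hUb ε hε3 (ξ - η)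
      have h2 := hV η hη ε hε2
      have h3 := rpow_split hp.le hc₀.le (norm_nonneg ξ) hκ'0.le hκ'2 hle
      calc ‖U ε (ξ - η)‖ * ‖V ε η‖
          ≤ (c' * Real.exp (k' * s)) * (d * Real.exp (l * s - μ * ‖η‖ ^ p)) := by gcongr
        _ = (c' * d) * Real.exp ((k' + l) * s - μ * ‖η‖ ^ p) := by
            rw [add_mul, add_sub_assoc, Real.exp_add]; ring
        _ ≤ D * Real.exp ((K * s - κ' * c₀ ^ p * ‖ξ‖ ^ p) + -κ' * ‖η‖ ^ p) := by
            have h4 : (k' + l) * s ≤ K * s := by gcongr; exact le_max_right _ _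
            have h5 : c' * d ≤ D := by
              have : 0 ≤ c * d' := by positivity
              linarith
            gcongr
            linarith
        _ = T * E η := by rw [Real.exp_add, hT, hE]; ring
        _ ≤ _ := by have := hE0 (ξ - η); gcongr; linarith
    · have h1 := hVb ε hε4 η
      have h2 := hU _ hη ε hε1
      have h3 := rpow_split hp.le hc₀.le (norm_nonneg ξ) hκ'0.le hκ'1 hle
      calc ‖U ε (ξ - η)‖ * ‖V ε η‖
          ≤ (c * Real.exp (k * s - κ * ‖ξ - η‖ ^ p)) * (d' * Real.exp (l' * s)) := by gcongr
        _ = (c * d') * Real.exp ((k + l') * s - κ * ‖ξ - η‖ ^ p) := by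
            rw [add_mul, show k * s + l' * s - κ * ‖ξ - η‖ ^ p
              = (k * s - κ * ‖ξ - η‖ ^ p) + l' * s by ring, Real.exp_add]; ring
        _ ≤ D * Real.exp ((K * s - κ' * c₀ ^ p * ‖ξ‖ ^ p) + -κ' * ‖ξ - η‖ ^ p) := by
            have h4 : (k + l') * s ≤ K * s := by gcongr; exact le_max_left _ _
            have h5 : c * d' ≤ D := by
              have : 0 ≤ c' * d := by positivity
              linarith
            gcongr
            linarith
        _ = T * E (ξ - η) := by rw [Real.exp_add, hT, hE]; ring
        _ ≤ _ := by have := hE0 η; gcongr; linarith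
  have hEi' : Integrable fun η => E (ξ - η) := hEi.comp_sub_left ξ
  calc ‖∫ η, U ε (ξ - η) * V ε η‖ ≤ ∫ η, T * (E η + E (ξ - η)) :=
        norm_integral_le_of_norm_le ((hEi.add hEi').const_mul T) (Eventually.of_forall hbound)
    _ = T * (2 * J) := by
        rw [integral_const_mul, integral_add hEi hEi', integral_sub_left_eq_self E volume ξ]
        ring
    _ ≤ T * (2 * J + 1) := by gcongr; linarith
    _ = _ := by rw [hT]; ring

/-! ### Localisation and gluing of representatives -/

theorem fourier_sub_of_integrable {u v : Eu m → ℂ} (hu : Integrable u) (hv : Integrable v) :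
    𝓕 (u - v) = 𝓕 u - 𝓕 v := by
  funext ξ
  simp only [Pi.sub_apply, Real.fourier_eq]
  rw [← integral_sub ((Real.fourierIntegral_convergent_iff ξ).2 hu)
    ((Real.fourierIntegral_convergent_iff ξ).2 hv)]
  simp only [smul_sub]

theorem fourierInv_sub_of_integrable {u v : Eu m → ℂ} (hu : Integrable u) (hv : Integrable v) :
    𝓕⁻ (u - v) = 𝓕⁻ u - 𝓕⁻ v := by
  funext x
  simp only [Pi.sub_apply, Real.fourierInv_eq_fourier_neg, fourier_sub_of_integrable hu hv]

variable {ψ : Eu m → ℂ}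

/-- A test function as a constant moderate net. -/
def constNet (hφ : φ ∈ gevreyTest σ Ω) : moderate σ Ω :=
  ⟨fun _ => φ, isModerate_const hφ.1.1⟩

theorem cl_mul (u v : moderate σ Ω) : cl (u * v) = cl u * cl v :=
  map_mul _ _ _

theorem cl_constNet (hφ : φ ∈ gevreyTest σ Ω) : cl (constNet hφ) = ofGevrey φ hφ.1 := rfl

theorem cl_eq_iff {u v : moderate σ Ω} : cl u = cl v ↔ IsNull σ Ω ((u : Net m) - (v : Net m)) :=
  Ideal.Quotient.eq

theorem constNet_mul_eq_zero_off (hφ : φ ∈ gevreyTest σ Ω) (u : moderate σ Ω) (ε : Ioc (0 : ℝ) 1) :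
    ∀ x ∉ tsupport φ, ((constNet hφ * u : moderate σ Ω) : Net m) ε x = 0 := by
  intro x hx
  show φ x * (u : Net m) ε x = 0
  rw [eq_zero_off_tsupport x hx, zero_mul]

theorem mul_eq_left_of_tsupport_subset (h : tsupport ψ ⊆ {x | φ x = 1}) : ψ * φ = ψ := by
  funext x
  by_cases hx : x ∈ tsupport ψ
  · rw [Pi.mul_apply, show φ x = 1 from h hx, mul_one]
  · rw [Pi.mul_apply, eq_zero_off_tsupport x hx, zero_mul]

theorem constNet_mul_constNet (hφ : φ ∈ gevreyTest σ Ω) (hψ : ψ ∈ gevreyTest σ Ω)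
    (h : tsupport ψ ⊆ {x | φ x = 1}) : constNet hψ * constNet hφ = constNet hψ :=
  Subtype.ext (funext fun _ => mul_eq_left_of_tsupport_subset h)

theorem rapidMod_fourier_constNet_mul (hψ : ψ ∈ gevreyTest σ Ω) (u : moderate σ Ω) :
    RapidMod σ fun ε => 𝓕 (((constNet hψ * u : moderate σ Ω) : Net m) ε) :=
  IsModerate.rapidMod_fourier (constNet hψ * u).2 hψ.2.1 hψ.2.2 (constNet_mul_eq_zero_off hψ u)

theorem contDiff_constNet_mul (hψ : ψ ∈ gevreyTest σ Ω) (u : moderate σ Ω) (ε : Ioc (0 : ℝ) 1) :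
    ContDiff ℝ ∞ (((constNet hψ * u : moderate σ Ω) : Net m) ε) :=
  contDiff_of_eq_zero_off hψ.2.1 hψ.2.2 ((constNet hψ * u).2.1 ε) (constNet_mul_eq_zero_off hψ u ε)

theorem integrable_constNet_mul (hψ : ψ ∈ gevreyTest σ Ω) (u : moderate σ Ω)
    (ε : Ioc (0 : ℝ) 1) : Integrable (((constNet hψ * u : moderate σ Ω) : Net m) ε) :=
  integrable_of_eq_zero_off hψ.2.1 (contDiff_constNet_mul hψ u ε) (constNet_mul_eq_zero_off hψ u ε)

theorem rapidNull_fourier_sub (hψ : ψ ∈ gevreyTest σ Ω) {u v : moderate σ Ω}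
    (h : cl (constNet hψ * u) = cl (constNet hψ * v)) :
    RapidNull σ ((fun ε => 𝓕 (((constNet hψ * u : moderate σ Ω) : Net m) ε)) -
      fun ε => 𝓕 (((constNet hψ * v : moderate σ Ω) : Net m) ε)) := by
  have h1 := (cl_eq_iff.1 h).rapidNull_fourier hψ.2.1 hψ.2.2 fun ε x hx => by
    simp only [Pi.sub_apply, constNet_mul_eq_zero_off hψ _ ε x hx, sub_zero]
  convert h1 using 1
  funext ε
  exact (fourier_sub_of_integrable (integrable_constNet_mul hψ u ε)
    (integrable_constNet_mul hψ v ε)).symm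

theorem RapidMod.expBdd {U : Net m} (hU : RapidMod σ U) :
    ∃ k, ExpBdd σ k fun ε η => ‖U ε η‖ := by
  obtain ⟨k, hk⟩ := hU.2 0
  exact ⟨k, hk.of_le fun ε η => by simp [weighted]⟩

theorem decayOn_univ_fourier (hσ : 1 ≤ σ) (hψ : ψ ∈ gevreyTest σ Ω) :
    DecayOn σ univ fun _ => 𝓕 ψ := by
  obtain ⟨C, hC, κ, hκ, H⟩ := exists_fourier_gevreyTest_le hσ hψ
  refine ⟨0, κ, hκ, C, hC, ⟨1, by simp⟩, fun ξ _ ε _ => ?_⟩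
  rw [zero_mul, zero_sub, ← neg_mul]
  exact H ξ

theorem exists_expBdd_fourier (σ : ℝ) (ψ : Eu m → ℂ) :
    ∃ k, ExpBdd σ k fun (_ : Ioc (0 : ℝ) 1) η => ‖𝓕 ψ η‖ :=
  ⟨0, (∫ x, ‖ψ x‖) + 1, by positivity, ⟨1, by simp⟩, fun ε _ η => by
    rw [zero_mul, Real.exp_zero, mul_one]
    linarith [norm_fourier_le_integral ψ η]⟩

/-- Multiplication by a Gevrey cutoff does not destroy decay: if `𝓕 w_ε = U_ε` decays on `Q`, then
`𝓕 (ψ w_ε)` decays on every region `Γ` that has relative distance `c₀` to the complement of `Q`. -/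
theorem decayOn_fourier_constNet_mul (hσ : 1 ≤ σ) (hψ : ψ ∈ gevreyTest σ Ω) {w : moderate σ Ω}
    {U : Net m} (hU : RapidMod σ U) (hw : ∀ ε, (w : Net m) ε = 𝓕⁻ (U ε)) {Q Γ : Set (Eu m)}
    (hQ : DecayOn σ Q U) {c₀ : ℝ} (hc₀ : 0 < c₀)
    (H : ∀ ξ ∈ Γ, ∀ η, ‖ξ - η‖ < c₀ * ‖ξ‖ → η ∈ Q) :
    DecayOn σ Γ fun ε => 𝓕 (((constNet hψ * w : moderate σ Ω) : Net m) ε) := by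
  have hψi : Integrable ψ := integrable_of_eq_zero_off hψ.2.1 (contDiff_of_mem_gevreyTest hψ)
    eq_zero_off_tsupport
  refine (DecayOn.convolution hσ (decayOn_univ_fourier hσ hψ) hQ (exists_expBdd_fourier σ ψ)
    hU.expBdd (c₀ := min c₀ (1 / 2)) (by positivity) (Γ := Γ) fun ξ hξ η => ?_).congr
    fun ε ξ _ => ?_
  · rcases le_or_gt (min c₀ (1 / 2) * ‖ξ‖) ‖ξ - η‖ with h | h
    · exact Or.inr ⟨mem_univ _, h⟩
    · left
      have h1 : min c₀ (1 / 2) * ‖ξ‖ ≤ c₀ * ‖ξ‖ := by gcongr; exact min_le_left _ _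
      have h2 : min c₀ (1 / 2) * ‖ξ‖ ≤ 1 / 2 * ‖ξ‖ := by gcongr; exact min_le_right _ _
      have h3 := norm_sub_norm_le ξ η
      exact ⟨H ξ hξ η (h.trans_le h1), by linarith⟩
  · show _ = 𝓕 (ψ * (w : Net m) ε) ξ
    rw [hw, fourier_mul_fourierInv hψi (hU.1 ε).integrable]

/-- The open cone around `ξ₁` with aperture `r`. -/
def openCone (ξ₁ : Eu m) (r : ℝ) : Set (Eu m) := {ξ | ∃ t > (0 : ℝ), ‖ξ - t • ξ₁‖ < t * r}

theorem isConicNhd_openCone (ξ₁ : Eu m) {r : ℝ} (hr : 0 < r) : IsConicNhd (openCone ξ₁ r) ξ₁ := by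
  refine ⟨?_, ⟨1, one_pos, by simpa using hr⟩, ?_⟩
  · have : openCone ξ₁ r = ⋃ t ∈ Ioi (0 : ℝ), {ξ : Eu m | ‖ξ - t • ξ₁‖ < t * r} := by
      ext ξ; simp [openCone]
    rw [this]
    exact isOpen_biUnion fun t _ => isOpen_lt (by fun_prop) continuous_const
  · rintro s hs ξ ⟨t, ht, h⟩
    refine ⟨s * t, by positivity, ?_⟩
    rw [mul_smul, ← smul_sub, norm_smul, Real.norm_of_nonneg hs.le, mul_assoc]
    gcongr

theorem exists_openCone_separated {Γ : Set (Eu m)} {ξ₁ : Eu m} (h : IsConicNhd Γ ξ₁) :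
    ∃ r > (0 : ℝ), ∃ c₀ > (0 : ℝ), ∀ ξ ∈ openCone ξ₁ r, ∀ η, ‖ξ - η‖ < c₀ * ‖ξ‖ → η ∈ Γ := by
  obtain ⟨hΓ, hξ₁, hcone⟩ := h
  obtain ⟨ρ, hρ, hball⟩ := Metric.isOpen_iff.1 hΓ ξ₁ hξ₁
  refine ⟨ρ / 2, by positivity, (ρ / 2) / (‖ξ₁‖ + ρ / 2), by positivity, ?_⟩
  rintro ξ ⟨t, ht, hξ⟩ η hη
  have h1 : ‖ξ‖ ≤ t * (‖ξ₁‖ + ρ / 2) := by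
    have := norm_add_le (ξ - t • ξ₁) (t • ξ₁)
    rw [sub_add_cancel, norm_smul, Real.norm_of_nonneg ht.le] at this
    linarith
  have h2 : ‖ξ - η‖ < t * (ρ / 2) := by
    refine hη.trans_le ?_
    rw [div_mul_eq_mul_div, div_le_iff₀ (by positivity)]
    calc ρ / 2 * ‖ξ‖ ≤ ρ / 2 * (t * (‖ξ₁‖ + ρ / 2)) := by gcongr
      _ = _ := by ring
  have h3 : ‖η - t • ξ₁‖ < t * ρ := by
    have := norm_add_le (η - ξ) (ξ - t • ξ₁)
    rw [sub_add_sub_cancel, norm_sub_rev η ξ] at this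
    linarith
  have h4 : t⁻¹ • η ∈ Γ := by
    apply hball
    rw [mem_ball_iff_norm]
    have e : t⁻¹ • η - ξ₁ = t⁻¹ • (η - t • ξ₁) := by
      rw [smul_sub, smul_smul, inv_mul_cancel₀ ht.ne', one_smul]
    rw [e, norm_smul, Real.norm_of_nonneg (by positivity), inv_mul_lt_iff₀ ht]
    exact h3
  have h5 := hcone t ht _ h4
  rwa [smul_smul, mul_inv_cancel₀ ht.ne', one_smul] at h5

open Classical in
/-- The decay estimate at different directions is only available for different representatives.
On a compact set of regular directions they are glued, on the Fourier side, to one net that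
differs from the Fourier transform of `ψ F_ε` by a null net. -/
theorem exists_glued (hσ : 1 ≤ σ) (F : moderate σ Ω) {x₀ : Eu m} {D : Set (Eu m)}
    (hD : IsCompact D) (hD0 : ∀ ξ ∈ D, ξ ≠ 0) (hreg : ∀ ξ ∈ D, ξ ∉ singConeAt (cl F) x₀) :
    ∃ O : Set (Eu m), IsOpen O ∧ (∀ t > (0 : ℝ), ∀ ξ ∈ O, t • ξ ∈ O) ∧ D ⊆ O ∧
      ∃ W ∈ 𝓝 x₀, ∀ (ψ : Eu m → ℂ) (hψ : ψ ∈ gevreyTest σ Ω), tsupport ψ ⊆ W →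
        ∃ U : Net m, RapidNull σ
          ((fun ε => 𝓕 (((constNet hψ * F : moderate σ Ω) : Net m) ε)) - U) ∧
          DecayOn σ O U := by
  refine hD.induction_on (p := fun D => ∃ O : Set (Eu m), IsOpen O ∧
      (∀ t > (0 : ℝ), ∀ ξ ∈ O, t • ξ ∈ O) ∧ D ⊆ O ∧
      ∃ W ∈ 𝓝 x₀, ∀ (ψ : Eu m → ℂ) (hψ : ψ ∈ gevreyTest σ Ω), tsupport ψ ⊆ W →
        ∃ U : Net m, RapidNull σ
          ((fun ε => 𝓕 (((constNet hψ * F : moderate σ Ω) : Net m) ε)) - U) ∧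
          DecayOn σ O U) ?_ ?_ ?_ ?_
  · refine ⟨∅, isOpen_empty, fun _ _ _ h => h.elim, Subset.rfl, univ, univ_mem,
      fun ψ hψ _ => ⟨_, rapidNull_fourier_sub hψ rfl, decayOn_empty⟩⟩
  · rintro S T hST ⟨O, h1, h2, h3, h4⟩
    exact ⟨O, h1, h2, hST.trans h3, h4⟩
  · rintro S T ⟨O, hO, hOc, hSO, W, hW, H⟩ ⟨O', hO', hOc', hTO', W', hW', H'⟩
    refine ⟨O ∪ O', hO.union hO', fun t ht ξ hξ => hξ.imp (hOc t ht ξ) (hOc' t ht ξ),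
      union_subset_union hSO hTO', W ∩ W', inter_mem hW hW', fun ψ hψ hsub => ?_⟩
    obtain ⟨U, hU, hUO⟩ := H ψ hψ (hsub.trans inter_subset_left)
    obtain ⟨U', hU', hUO'⟩ := H' ψ hψ (hsub.trans inter_subset_right)
    refine ⟨fun ε => O.piecewise (U ε) (U' ε), ?_, ?_⟩
    · convert hU.piecewise hU' hO.measurableSet using 1
      funext ε ξ
      by_cases h : ξ ∈ O
      · simp [h]
      · simp [h]
    -- On `O` the glued net is `U`, and on `O' \ O` it is `U'`.
    · have e : O ∪ O' = O ∪ (O' \ O) := by simp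
      rw [e]
      refine (hUO.congr fun ε ξ hξ => ?_).union
        ((hUO'.mono sdiff_subset).congr fun ε ξ hξ => ?_)
      · simp [hξ]
      · simp [hξ.2]
  -- Near one direction, the representative is the one given by its regularity, cut off by `ψ`.
  · intro ξ₁ hξ₁
    have h1 := hreg ξ₁ hξ₁
    have h0 := hD0 ξ₁ hξ₁
    simp only [singConeAt, mem_ofPred_eq, not_and, not_forall] at h1
    obtain ⟨φ, hφ, hφ1, h2⟩ := h1 h0
    simp only [singCone, mem_ofPred_eq, not_and, not_not] at h2
    obtain ⟨Γ, hΓ, u, hu, ⟨K, hK, hKΩ, huK⟩, hdecay⟩ := h2 h0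
    obtain ⟨r, hr, c₀, hc₀, hsep⟩ := exists_openCone_separated hΓ
    obtain ⟨hO, hξO, hOc⟩ := isConicNhd_openCone ξ₁ hr
    refine ⟨openCone ξ₁ r, mem_nhdsWithin_of_mem_nhds (hO.mem_nhds hξO), openCone ξ₁ r, hO, hOc,
      Subset.rfl, {x | φ x = 1}, hφ1, fun ψ hψ hsub => ?_⟩
    have hus : ∀ ε, ContDiff ℝ ∞ ((u : Net m) ε) := fun ε =>
      contDiff_of_eq_zero_off hK hKΩ (u.2.1 ε) (huK ε)
    refine ⟨fun ε => 𝓕 (((constNet hψ * u : moderate σ Ω) : Net m) ε),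
      rapidNull_fourier_sub hψ ?_, ?_⟩
    · rw [cl_mul _ u, hu, ← cl_constNet hφ, ← mul_assoc, ← cl_mul _ (constNet hφ),
        constNet_mul_constNet hφ hψ hsub, cl_mul]
    · exact decayOn_fourier_constNet_mul hσ hψ (IsModerate.rapidMod_fourier u.2 hK hKΩ huK)
        (fun ε => (fourierInv_fourier_of_eq_zero_off hK (hus ε) (huK ε)).symm)
        (hdecay.decayOn hσ hΓ.2.2) hc₀ hsep

/-- Near `x₀` a generalized function is represented by inverse Fourier transforms `𝓕⁻ U_ε` with
`U_ε` decaying on a cone that contains a given compact set of regular directions. -/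
theorem exists_spectral_representative (hσ : 1 ≤ σ) (f : G σ Ω) {x₀ : Eu m} (hx₀ : x₀ ∈ Ω)
    (hφ : φ ∈ gevreyTest σ Ω) (hφ1 : ∀ᶠ x in 𝓝 x₀, φ x = 1) {D : Set (Eu m)}
    (hD : IsCompact D) (hD0 : ∀ ξ ∈ D, ξ ≠ 0) (hreg : ∀ ξ ∈ D, ξ ∉ singConeAt f x₀) :
    ∃ O : Set (Eu m), (∀ t > (0 : ℝ), ∀ ξ ∈ O, t • ξ ∈ O) ∧ D ⊆ O ∧
      ∃ (ψ : Eu m → ℂ) (hψ : ψ ∈ gevreyTest σ Ω), (∀ᶠ x in 𝓝 x₀, ψ x = 1) ∧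
        ∃ (U : Net m) (w : moderate σ Ω), RapidMod σ U ∧ DecayOn σ O U ∧
          (∀ ε, (w : Net m) ε = 𝓕⁻ (U ε)) ∧ cl w = ofGevrey ψ hψ.1 * f := by
  obtain ⟨F, rfl⟩ := Ideal.Quotient.mk_surjective f
  obtain ⟨O, _, hOc, hDO, W, hW, H⟩ := exists_glued hσ F hD hD0 hreg
  obtain ⟨ψ, hψ, hψ1, hψW⟩ := exists_gevreyTest_tsupport_subset hx₀ hφ hφ1 hW
  obtain ⟨U, hU, hUO⟩ := H ψ hψ hψW
  have hbase := rapidMod_fourier_constNet_mul hψ F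
  have hUm : RapidMod σ U := by
    have := hbase.sub hU.rapidMod
    rwa [sub_sub_cancel] at this
  refine ⟨O, hOc, hDO, ψ, hψ, hψ1, U, ⟨_, hUm.isModerate⟩, hUm, hUO, fun _ => rfl, ?_⟩
  rw [← cl_constNet hψ]
  show _ = cl (constNet hψ) * cl F
  rw [← cl_mul, eq_comm, cl_eq_iff]
  convert hU.isNull (Ω := Ω) using 1
  funext ε
  show _ = 𝓕⁻ (𝓕 _ - U ε)
  rw [fourierInv_sub_of_integrable (hbase.1 ε).integrable (hUm.1 ε).integrable,
    fourierInv_fourier_of_eq_zero_off hψ.2.1 (contDiff_constNet_mul hψ F ε)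
      (constNet_mul_eq_zero_off hψ F ε)]
  rfl

/-! ### Geometry of cones -/

/-- The cone around `A ∪ {0}` of relative width `r`. -/
def fatten (A : Set (Eu m)) (r : ℝ) : Set (Eu m) := {a | ∃ s ∈ insert 0 A, ‖a - s‖ ≤ r * ‖a‖}

theorem zero_mem_fatten (A : Set (Eu m)) (r : ℝ) : (0 : Eu m) ∈ fatten A r :=
  ⟨0, mem_insert _ _, by simp⟩

theorem fatten_mono (A : Set (Eu m)) {r r' : ℝ} (h : r ≤ r') : fatten A r ⊆ fatten A r' := by
  rintro a ⟨s, hs, has⟩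
  exact ⟨s, hs, has.trans (by gcongr)⟩

theorem smul_mem_insert_zero {A : Set (Eu m)} (hA : ∀ t > (0 : ℝ), ∀ a ∈ A, t • a ∈ A) {t : ℝ}
    (ht : 0 < t) {a : Eu m} (ha : a ∈ insert 0 A) : t • a ∈ insert 0 A := by
  rcases ha with rfl | ha
  · simp
  · exact mem_insert_of_mem _ (hA t ht a ha)

/-- The hypotheses on `A`, `B` and `ξ₀` say that `a + b - τ ξ₀` has no nontrivial zero. By
compactness and homogeneity this is quantitative. -/
theorem exists_le_norm_add_sub_smul {A B : Set (Eu m)} {ξ₀ : Eu m}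
    (hA : IsClosed (insert 0 A)) (hB : IsClosed (insert 0 B))
    (hAc : ∀ t > (0 : ℝ), ∀ a ∈ A, t • a ∈ A) (hBc : ∀ t > (0 : ℝ), ∀ b ∈ B, t • b ∈ B)
    (hA0 : (0 : Eu m) ∉ A) (h0 : ξ₀ ≠ 0) (hξA : ξ₀ ∉ A) (hξB : ξ₀ ∉ B)
    (hsum0 : ∀ a ∈ A, ∀ b ∈ B, a + b ≠ 0) (hsum : ∀ a ∈ A, ∀ b ∈ B, a + b ≠ ξ₀) :
    ∃ δ > (0 : ℝ), ∀ a ∈ insert 0 A, ∀ b ∈ insert 0 B, ∀ τ ≥ (0 : ℝ),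
      δ * (‖a‖ + ‖b‖ + τ) ≤ ‖a + b - τ • ξ₀‖ := by
  -- The compact section of the cone of all `(a, b, τ)` on which the minimum is taken.
  let X : Set (Eu m × Eu m × ℝ) :=
    {p | p.1 ∈ insert 0 A ∧ p.2.1 ∈ insert 0 B ∧ 0 ≤ p.2.2 ∧ ‖p.1‖ + ‖p.2.1‖ + p.2.2 = 1}
  have hXc : IsClosed X := by
    refine (hA.preimage continuous_fst).inter
      ((hB.preimage (continuous_fst.comp continuous_snd)).inter
        ((isClosed_le continuous_const (continuous_snd.comp continuous_snd)).inter
          (isClosed_eq (by fun_prop) continuous_const)))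
  have hXb : X ⊆ Metric.closedBall 0 1 := by
    rintro ⟨a, b, τ⟩ ⟨_, _, hτ, hn⟩
    rw [mem_closedBall_zero_iff, Prod.norm_def, Prod.norm_def]
    simp only at hτ hn ⊢
    have ha := norm_nonneg a
    have hb := norm_nonneg b
    rw [Real.norm_of_nonneg hτ]
    exact max_le (by linarith) (max_le (by linarith) (by linarith))
  have hX : IsCompact X := (isCompact_closedBall _ _).of_isClosed_subset hXc hXb
  have hXne : X.Nonempty :=
    ⟨(0, 0, 1), mem_insert _ _, mem_insert _ _, zero_le_one, by simp⟩
  obtain ⟨⟨a₁, b₁, τ₁⟩, hmem, hmin⟩ := hX.exists_isMinOn hXne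
    (f := fun p => ‖p.1 + p.2.1 - p.2.2 • ξ₀‖) (by fun_prop)
  have hpos : 0 < ‖a₁ + b₁ - τ₁ • ξ₀‖ := by
    obtain ⟨ha, hb, hτ, hn⟩ := hmem
    simp only at ha hb hτ hn
    rw [norm_pos_iff, sub_ne_zero]
    intro heq
    rcases hτ.eq_or_lt with rfl | hτ
    · rw [zero_smul] at heq
      rcases ha with rfl | ha
      · rw [zero_add] at heq
        subst heq
        simp at hn
      · rcases hb with rfl | hb
        · rw [add_zero] at heq
          exact hA0 (heq ▸ ha)
        · exact hsum0 _ ha _ hb heq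
    · have h1 : τ₁⁻¹ • a₁ + τ₁⁻¹ • b₁ = ξ₀ := by
        rw [← smul_add, heq, smul_smul, inv_mul_cancel₀ hτ.ne', one_smul]
      have hτ' : 0 < τ₁⁻¹ := inv_pos.2 hτ
      rcases ha with rfl | ha
      · rcases hb with rfl | hb
        · exact h0 (by simpa using h1.symm)
        · exact hξB (h1 ▸ by simpa using hBc _ hτ' _ hb)
      · rcases hb with rfl | hb
        · exact hξA (h1 ▸ by simpa using hAc _ hτ' _ ha)
        · exact hsum _ (hAc _ hτ' _ ha) _ (hBc _ hτ' _ hb) h1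
  refine ⟨_, hpos, fun a ha b hb τ hτ => ?_⟩
  set N := ‖a‖ + ‖b‖ + τ with hN
  have hN0 : 0 ≤ N := by positivity
  rcases hN0.eq_or_lt with h | h
  · rw [← h, mul_zero]; positivity
  · have hi : 0 < N⁻¹ := inv_pos.2 h
    have h2 : (N⁻¹ • a, N⁻¹ • b, N⁻¹ * τ) ∈ X := by
      refine ⟨smul_mem_insert_zero hAc hi ha, smul_mem_insert_zero hBc hi hb, by positivity, ?_⟩
      simp only [norm_smul, Real.norm_of_nonneg hi.le]
      rw [← mul_add, ← mul_add, inv_mul_cancel₀ h.ne']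
    have h3 : ‖a₁ + b₁ - τ₁ • ξ₀‖ ≤ ‖N⁻¹ • a + N⁻¹ • b - (N⁻¹ * τ) • ξ₀‖ :=
      isMinOn_iff.1 hmin (N⁻¹ • a, N⁻¹ • b, N⁻¹ * τ) h2
    rw [mul_smul, ← smul_add, ← smul_sub, norm_smul, Real.norm_of_nonneg hi.le,
      le_inv_mul_iff₀ h] at h3
    linarith

/-- Around `ξ₀` every frequency splits as `(ξ - η) + η` with at least one summand away from the
corresponding cone and comparable to `ξ`. -/
theorem exists_splitting {A B : Set (Eu m)} {ξ₀ : Eu m} {δ : ℝ} (hδ : 0 < δ)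
    (H : ∀ a ∈ insert 0 A, ∀ b ∈ insert 0 B, ∀ τ ≥ (0 : ℝ),
      δ * (‖a‖ + ‖b‖ + τ) ≤ ‖a + b - τ • ξ₀‖) :
    ∃ r > (0 : ℝ), r ≤ 1 ∧ ∃ Γ, IsConicNhd Γ ξ₀ ∧ ∃ c₀ > (0 : ℝ), ∀ ξ ∈ Γ, ∀ η,
      (η ∈ (fatten B r)ᶜ ∧ c₀ * ‖ξ‖ ≤ ‖η‖) ∨
        (ξ - η ∈ (fatten A r)ᶜ ∧ c₀ * ‖ξ‖ ≤ ‖ξ - η‖) := by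
  set r := min (1 / 2) (δ / 4) with hr
  have hr0 : 0 < r := by positivity
  have hr1 : r ≤ 1 / 2 := min_le_left _ _
  have hr2 : r ≤ δ / 4 := min_le_right _ _
  have key : ∀ a ∈ fatten A r, ∀ b ∈ fatten B r, ∀ τ ≥ (0 : ℝ),
      δ / 4 * τ ≤ ‖a + b - τ • ξ₀‖ := by
    rintro a ⟨s, hs, has⟩ b ⟨t, ht, hbt⟩ τ hτ
    have h1 := H s hs t ht τ hτ
    have h2 : ‖s + t - τ • ξ₀‖ ≤ ‖a + b - τ • ξ₀‖ + (‖a - s‖ + ‖b - t‖) := by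
      have e : s + t - τ • ξ₀ = (a + b - τ • ξ₀) - ((a - s) + (b - t)) := by abel
      rw [e]
      exact (norm_sub_le _ _).trans (by gcongr; exact norm_add_le _ _)
    have h3 : ‖a‖ ≤ ‖s‖ + ‖a - s‖ := by
      have := norm_add_le s (a - s); rwa [add_sub_cancel] at this
    have h4 : ‖b‖ ≤ ‖t‖ + ‖b - t‖ := by
      have := norm_add_le t (b - t); rwa [add_sub_cancel] at this
    have h5 : r * ‖a‖ ≤ 1 / 2 * ‖a‖ := by gcongr
    have h6 : r * ‖b‖ ≤ 1 / 2 * ‖b‖ := by gcongr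
    have h7 : r * ‖a‖ ≤ δ / 4 * ‖a‖ := by gcongr
    have h8 : r * ‖b‖ ≤ δ / 4 * ‖b‖ := by gcongr
    have h9 : δ * (1 / 2 * ‖a‖ + 1 / 2 * ‖b‖ + τ) ≤ δ * (‖s‖ + ‖t‖ + τ) := by
      gcongr <;> linarith
    nlinarith [mul_nonneg hδ.le (norm_nonneg a), mul_nonneg hδ.le (norm_nonneg b),
      mul_nonneg hδ.le hτ]
  set ρ := δ / 8 with hρ
  have hρ0 : 0 < ρ := by positivity
  refine ⟨r, hr0, by linarith, openCone ξ₀ ρ, isConicNhd_openCone ξ₀ hρ0,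
    min (ρ / (‖ξ₀‖ + ρ)) (1 / 2), by positivity, ?_⟩
  rintro ξ ⟨τ, hτ, hξ⟩ η
  have h1 : ‖ξ‖ ≤ τ * (‖ξ₀‖ + ρ) := by
    have := norm_add_le (ξ - τ • ξ₀) (τ • ξ₀)
    rw [sub_add_cancel, norm_smul, Real.norm_of_nonneg hτ.le] at this
    linarith
  have h2 : min (ρ / (‖ξ₀‖ + ρ)) (1 / 2) * ‖ξ‖ ≤ τ * ρ := by
    calc _ ≤ ρ / (‖ξ₀‖ + ρ) * (τ * (‖ξ₀‖ + ρ)) := by gcongr; exact min_le_left _ _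
      _ = _ := by field_simp
  have h3 : min (ρ / (‖ξ₀‖ + ρ)) (1 / 2) * ‖ξ‖ ≤ 1 / 2 * ‖ξ‖ := by
    gcongr; exact min_le_right _ _
  by_cases hη : η ∈ fatten B r
  · by_cases hξη : ξ - η ∈ fatten A r
    · have := key _ hξη _ hη τ hτ.le
      rw [sub_add_cancel] at this
      nlinarith
    · right
      refine ⟨hξη, h2.trans ?_⟩
      have h4 := key 0 (zero_mem_fatten A r) η hη τ hτ.le
      have h5 : ‖0 + η - τ • ξ₀‖ ≤ ‖ξ - τ • ξ₀‖ + ‖ξ - η‖ := by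
        have e : 0 + η - τ • ξ₀ = (ξ - τ • ξ₀) - (ξ - η) := by abel
        rw [e]; exact norm_sub_le _ _
      nlinarith
  · by_cases hξη : ξ - η ∈ fatten A r
    · left
      refine ⟨hη, h2.trans ?_⟩
      have h4 := key _ hξη 0 (zero_mem_fatten B r) τ hτ.le
      have h5 : ‖ξ - η + 0 - τ • ξ₀‖ ≤ ‖ξ - τ • ξ₀‖ + ‖η‖ := by
        have e : ξ - η + 0 - τ • ξ₀ = (ξ - τ • ξ₀) - η := by abel
        rw [e]; exact norm_sub_le _ _
      nlinarith
    · have h4 : ‖ξ‖ ≤ ‖ξ - η‖ + ‖η‖ := by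
        have := norm_add_le (ξ - η) η; rwa [sub_add_cancel] at this
      rcases le_total (1 / 2 * ‖ξ‖) ‖η‖ with h | h
      · exact Or.inl ⟨hη, h3.trans h⟩
      · exact Or.inr ⟨hξη, by linarith⟩

/-- The complement of a fattened cone is a relative neighbourhood of that of a wider one. -/
theorem notMem_fatten_of_near {A : Set (Eu m)} {r : ℝ} (hr : 0 < r) (hr1 : r ≤ 1) {ξ η : Eu m}
    (hξ : ξ ∉ fatten A r) (h : ‖ξ - η‖ < r / 3 * ‖ξ‖) : η ∉ fatten A (r / 3) := by
  rintro ⟨s, hs, hηs⟩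
  refine hξ ⟨s, hs, ?_⟩
  have h1 : ‖ξ - s‖ ≤ ‖ξ - η‖ + ‖η - s‖ := by
    have := norm_add_le (ξ - η) (η - s); rwa [sub_add_sub_cancel] at this
  have h2 : ‖η‖ ≤ ‖ξ‖ + ‖ξ - η‖ := by
    have := norm_sub_le ξ (ξ - η); rwa [sub_sub_cancel] at this
  have h3 : r / 3 * ‖ξ‖ ≤ 1 / 3 * ‖ξ‖ := by gcongr
  have h4 : r / 3 * ‖η‖ ≤ r / 3 * (2 * ‖ξ‖) := by gcongr; linarith [norm_nonneg ξ]
  linarith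

/-- The unit vectors at distance at least `r` from `A ∪ {0}`. -/
def farSphere (A : Set (Eu m)) (r : ℝ) : Set (Eu m) :=
  {x | x ∈ Metric.sphere 0 1 ∧ ∀ s ∈ insert 0 A, r ≤ ‖x - s‖}

theorem isCompact_farSphere (A : Set (Eu m)) (r : ℝ) : IsCompact (farSphere A r) := by
  refine (isCompact_sphere (0 : Eu m) 1).inter_right (t := {x | ∀ s ∈ insert 0 A, r ≤ ‖x - s‖}) ?_
  simp only [ofPred_forall]
  exact isClosed_biInter fun s _ => isClosed_le continuous_const (by fun_prop)

theorem compl_fatten_subset {A O : Set (Eu m)} {r : ℝ}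
    (hA : ∀ t > (0 : ℝ), ∀ a ∈ A, t • a ∈ A) (hO : ∀ t > (0 : ℝ), ∀ ξ ∈ O, t • ξ ∈ O)
    (h : farSphere A r ⊆ O) : (fatten A r)ᶜ ⊆ O := by
  intro a ha
  have ha0 : a ≠ 0 := by
    rintro rfl
    exact ha (zero_mem_fatten A r)
  have hn : 0 < ‖a‖ := norm_pos_iff.2 ha0
  have h1 : ‖a‖⁻¹ • a ∈ farSphere A r := by
    refine ⟨by simp [norm_smul, hn.ne'], fun s hs => ?_⟩
    by_contra! hlt
    refine ha ⟨‖a‖ • s, smul_mem_insert_zero hA hn hs, ?_⟩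
    have e : a - ‖a‖ • s = ‖a‖ • (‖a‖⁻¹ • a - s) := by
      rw [smul_sub, smul_smul, mul_inv_cancel₀ hn.ne', one_smul]
    rw [e, norm_smul, norm_norm, mul_comm]
    gcongr
  have h2 := hO _ hn _ (h h1)
  rwa [smul_smul, mul_inv_cancel₀ hn.ne', one_smul] at h2

/-! ### The cone of singular directions and the wave front of a product -/

theorem notMem_singConeAt_iff {f : G σ Ω} {x₀ ξ : Eu m} (hξ : ξ ≠ 0) :
    ξ ∉ singConeAt f x₀ ↔ ∃ (φ : Eu m → ℂ) (hφ : φ ∈ gevreyTest σ Ω), (∀ᶠ x in 𝓝 x₀, φ x = 1) ∧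
      ∃ Γ : Set (Eu m), IsConicNhd Γ ξ ∧ ∃ u : moderate σ Ω, cl u = ofGevrey φ hφ.1 * f ∧
        HasUniformCompactSupport Ω (u : Net m) ∧ FourierDecayOn σ Γ (u : Net m) := by
  simp only [singConeAt, singCone, mem_ofPred_eq, not_forall, not_not, hξ,
    ne_eq, not_false_eq_true, true_and, exists_prop]

theorem zero_notMem_singConeAt (f : G σ Ω) (x₀ : Eu m) : (0 : Eu m) ∉ singConeAt f x₀ :=
  fun h => h.1 rfl

theorem isClosed_insert_singConeAt (f : G σ Ω) (x₀ : Eu m) :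
    IsClosed (insert 0 (singConeAt f x₀)) := by
  rw [← isOpen_compl_iff, isOpen_iff_mem_nhds]
  intro ξ hξ
  simp only [mem_compl_iff, mem_insert_iff, not_or] at hξ
  obtain ⟨φ, hφ, hφ1, Γ, hΓ, hu⟩ := (notMem_singConeAt_iff hξ.1).1 hξ.2
  filter_upwards [hΓ.1.mem_nhds hΓ.2.1, isOpen_ne.mem_nhds hξ.1] with η hη hη0
  simp only [mem_compl_iff, mem_insert_iff, not_or]
  exact ⟨hη0, (notMem_singConeAt_iff hη0).2 ⟨φ, hφ, hφ1, Γ, ⟨hΓ.1, hη, hΓ.2.2⟩, hu⟩⟩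

theorem smul_mem_singConeAt (f : G σ Ω) (x₀ : Eu m) :
    ∀ t > (0 : ℝ), ∀ ξ ∈ singConeAt f x₀, t • ξ ∈ singConeAt f x₀ := by
  intro t ht ξ hξ
  by_contra h
  obtain ⟨φ, hφ, hφ1, Γ, hΓ, hu⟩ := (notMem_singConeAt_iff (smul_ne_zero ht.ne' hξ.1)).1 h
  refine (notMem_singConeAt_iff hξ.1).2 ⟨φ, hφ, hφ1, Γ, ⟨hΓ.1, ?_, hΓ.2.2⟩, hu⟩ hξ
  have := hΓ.2.2 t⁻¹ (inv_pos.2 ht) _ hΓ.2.1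
  rwa [smul_smul, inv_mul_cancel₀ ht.ne', one_smul] at this

theorem disjoint_farSphere {A : Set (Eu m)} {r : ℝ} (hr : 0 < r) : ∀ ξ ∈ farSphere A r, ξ ∉ A := by
  intro ξ hξ hA
  have := hξ.2 ξ (mem_insert_of_mem _ hA)
  rw [sub_self, norm_zero] at this
  linarith

theorem ne_zero_of_mem_farSphere {A : Set (Eu m)} {r : ℝ} : ∀ ξ ∈ farSphere A r, ξ ≠ 0 := by
  rintro ξ hξ rfl
  simpa using hξ.1

/-- The microlocal form of the theorem: a direction that is regular for `f` and `g` at `x₀` and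
is not a sum of singular directions is regular for `f g`. -/
theorem notMem_singConeAt_mul (hσ : 1 ≤ σ) {f g : G σ Ω} {x₀ ξ₀ : Eu m} (hx₀ : x₀ ∈ Ω)
    (h0 : ξ₀ ≠ 0) (hf : ξ₀ ∉ singConeAt f x₀) (hg : ξ₀ ∉ singConeAt g x₀)
    (hsum0 : ∀ a ∈ singConeAt f x₀, ∀ b ∈ singConeAt g x₀, a + b ≠ 0)
    (hsum : ∀ a ∈ singConeAt f x₀, ∀ b ∈ singConeAt g x₀, a + b ≠ ξ₀) :
    ξ₀ ∉ singConeAt (f * g) x₀ := by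
  -- The only source of Gevrey cutoffs at `x₀` is the regularity of `ξ₀`.
  obtain ⟨φ, hφ, hφ1, -⟩ := (notMem_singConeAt_iff h0).1 hf
  have hAc := smul_mem_singConeAt f x₀
  have hBc := smul_mem_singConeAt g x₀
  obtain ⟨δ, hδ, H⟩ := exists_le_norm_add_sub_smul (isClosed_insert_singConeAt f x₀)
    (isClosed_insert_singConeAt g x₀) hAc hBc (zero_notMem_singConeAt f x₀) h0 hf hg hsum0 hsum
  obtain ⟨r, hr, hr1, Γ, hΓ, c₀, hc₀, hsplit⟩ := exists_splitting hδ H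
  have hr3 : 0 < r / 3 := by positivity
  obtain ⟨O, hO, hDO, ψ, hψ, hψ1, U, w, hU, hUO, hw, hwf⟩ :=
    exists_spectral_representative hσ f hx₀ hφ hφ1 (isCompact_farSphere (singConeAt f x₀) (r / 3))
      ne_zero_of_mem_farSphere (disjoint_farSphere hr3)
  obtain ⟨O', hO', hDO', ψ', hψ', hψ1', U', w', hU', hUO', hw', hwg⟩ :=
    exists_spectral_representative hσ g hx₀ hφ hφ1 (isCompact_farSphere (singConeAt g x₀) (r / 3))
      ne_zero_of_mem_farSphere (disjoint_farSphere hr3)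
  have hP := hUO.mono (compl_fatten_subset hAc hO hDO)
  have hQ := (hUO'.mono (compl_fatten_subset hBc hO' hDO')).mono
    (compl_subset_compl.2 (fatten_mono (singConeAt g x₀) (show r / 3 ≤ r by linarith)))
  -- The cutoff `χ` lives where both localised representatives are unchanged, so that
  -- `χ w w'` represents `χ f g`.
  obtain ⟨χ, hχ, hχ1, hχs⟩ := exists_gevreyTest_tsupport_subset hx₀ hφ hφ1
    (inter_mem hψ1 hψ1')
  have hPχ := decayOn_fourier_constNet_mul hσ hχ hU hw hP hr3
    (Γ := (fatten (singConeAt f x₀) r)ᶜ) fun ξ hξ η h => notMem_fatten_of_near hr hr1 hξ h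
  refine (notMem_singConeAt_iff h0).2 ⟨χ, hχ, hχ1, Γ, hΓ, constNet hχ * w * w', ?_,
    ⟨tsupport χ, hχ.2.1, hχ.2.2, fun ε x hx => ?_⟩, ?_⟩
  · have e1 := constNet_mul_constNet hψ hχ (hχs.trans inter_subset_left)
    have e2 := constNet_mul_constNet hψ' hχ (hχs.trans inter_subset_right)
    rw [cl_mul, cl_mul, hwf, hwg, ← cl_constNet hψ, ← cl_constNet hψ', ← cl_constNet hχ]
    calc cl (constNet hχ) * (cl (constNet hψ) * f) * (cl (constNet hψ') * g)
        = cl (constNet hχ) * cl (constNet hψ) * cl (constNet hψ') * (f * g) := by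
          rw [← mul_assoc (cl (constNet hχ)) (cl (constNet hψ)) f]
          exact mul_mul_mul_comm (cl (constNet hχ) * cl (constNet hψ)) f (cl (constNet hψ')) g
      _ = cl (constNet hχ) * (f * g) := by rw [← cl_mul, e1, ← cl_mul, e2]
  · show ((constNet hχ * w : moderate σ Ω) : Net m) ε x * (w' : Net m) ε x = 0
    rw [constNet_mul_eq_zero_off hχ w ε x hx, zero_mul]
  · refine DecayOn.fourierDecayOn hΓ.2.2 ?_
    refine (DecayOn.convolution hσ hPχ hQ (rapidMod_fourier_constNet_mul hχ w).expBdd hU'.expBdd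
      hc₀ hsplit).congr fun ε ξ _ => ?_
    show _ = 𝓕 (((constNet hχ * w : moderate σ Ω) : Net m) ε * (w' : Net m) ε) ξ
    rw [hw', fourier_mul_fourierInv (integrable_constNet_mul hχ w ε) (hU'.1 ε).integrable]

end GevreyUltra

theorem mainTheorem1 (m : ℕ) (σ : ℝ) (hσ : 1 ≤ σ)
    (Ω : TopologicalSpace.Opens (GevreyUltra.Eu m)) (f g : GevreyUltra.G σ Ω)
    (hfg : ∀ x ∈ Ω, (x, (0 : GevreyUltra.Eu m)) ∉
      GevreyUltra.fiberSum (GevreyUltra.WF f) (GevreyUltra.WF g)) :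
    GevreyUltra.WF (f * g) ⊆
      GevreyUltra.fiberSum (GevreyUltra.WF f) (GevreyUltra.WF g) ∪
        GevreyUltra.WF f ∪ GevreyUltra.WF g := by
  rintro ⟨x, ξ⟩ ⟨hx, hξ⟩
  by_contra h
  simp only [mem_union, not_or] at h
  obtain ⟨⟨hs, hf⟩, hg⟩ := h
  exact GevreyUltra.notMem_singConeAt_mul hσ hx hξ.1 (fun h => hf ⟨hx, h⟩) (fun h => hg ⟨hx, h⟩)
    (fun a ha b hb e => hfg x hx ⟨a, b, ⟨hx, ha⟩, ⟨hx, hb⟩, e.symm⟩)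
    (fun a ha b hb e => hs ⟨a, b, ⟨hx, ha⟩, ⟨hx, hb⟩, e.symm⟩) hξ
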